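/- **Setting.** Let $N,R\ge 1$. The computational qubits are arranged in $R$ rows of $N$ qubits, $M=RN$ in total, $q=(r,j)$ being the qubit in row $r$ and column $j$. A set $Q_{\rm in}$ of $n$ qubits of the first row carries the input, and $q_{\rm out}$ is the rightmost qubit of the last row. The verifying circuit $V_x$ consists of one unitary gate $G_r$ on one or two qubits of row $r$, for each $r=1,\dots,R$, and is executed in $T=(2R-1)N$ steps $U_1,\dots,U_T$: in the $r$-th gate round a cursor visits the qubits of row $r$ from left to right, one per step, where $G_r$ is applied when the cursor reaches its leftmost qubit and every other step is an identity operation (on the visited qubit or, if $G_r$ has already acted on that qubit, on no qubit); after the $r$-th gate round, for $r<R$, the qubits of row $r$ are swapped with those of row $r+1$, column by column from right to left, one per step. Let $t_q$ be the first time at which a step acts on $q$ (identity operations on $q$ included). On input a normalized state $|\xi\rangle$ of the qubits in $Q_{\rm in}$ put $|\xi_0\rangle=|\xi\rangle|0^{M-n}\rangle$ and $|\xi_t\rangle=U_t|\xi_{t-1}\rangle$; $V_x$ accepts with the probability that a measurement of $q_{\rm out}$ in $|\xi_T\rangle$ gives $1$. Add clock qubits $c_1,\dots,c_T$ and let $$H^{(5)}=H_{\rm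 in}+H_{\rm out}+H_{\rm clock}+\tfrac12\sum_{t=1}^{T}H_{\rm evolv}(t),$$ $$H_{\rm in}=\sum_{q\notin Q_{\rm in}}|1\rangle\langle 1|_q\otimes|100\rangle\langle100|_{c_{t_q-1},c_{t_q},c_{t_q+1}},\quad H_{\rm out}=|0\rangle\langle0|_{q_{\rm out}}\otimes|1\rangle\langle1|_{c_T},\quad H_{\rm clock}=\sum_{t=1}^{T-1}|01\rangle\langle01|_{c_t,c_{t+1}},$$ $$H_{\rm evolv}(t)=|100\rangle\langle100|+|110\rangle\langle110|-U_t\otimes|110\rangle\langle100|-U_t^\dagger\otimes|100\rangle\langle110|\quad\text{on } c_{t-1},c_t,c_{t+1},$$ where at the boundaries the missing bits are read as $c_0=1$, $c_{T+1}=0$ (so e.g. $|100\rangle\langle100|$ means $|00\rangle\langle00|_{c_1,c_2}$ for $t=1$ and $|10\rangle\langle10|_{c_{T-1},c_T}$ for $t=T$). The interaction hypergraph has all $M+T$ qubits as vertices and, for every term of these sums, one hyperedge, consisting of the qubits on which the term acts nontrivially. It is spatially sparse with bound $K$ if every vertex lies in at most $K$ hyperedges and the vertices can be placed in the plane, at mutual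 distances at least $1$, such that the convex hull of every hyperedge has area at most $K$ and meets the convex hulls of at most $K$ other hyperedges. **Lemma.** There are universal constants $c>0$ and $K$ such that for all $N,R\ge1$ and all such circuits $H^{(5)}$ is Hermitian, every hyperedge has at most $5$ vertices, the interaction hypergraph is spatially sparse with bound $K$ provided that all two-qubit gates $G_r$ act on neighbouring qubits of their row, and, for every real $\epsilon$: 1. If $V_x$ accepts some input $|\xi\rangle$ with probability more than $1-\epsilon$, then the history state $|\psi\rangle=\sqrt{\tfrac1{T+1}}\sum_{t=0}^T|\xi_t\rangle|1^t0^{T-t}\rangle_{c_1\dots c_T}$ satisfies $\langle\psi|H^{(5)}|\psi\rangle<\frac{\epsilon}{T+1}$. 2. If $V_x$ accepts every input $|\xi\rangle$ with probability less than $\epsilon$, then all eigenvalues of $H^{(5)}$ are at least $\frac{c(1-\epsilon-\sqrt\epsilon)}{T^3}$. -/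

import Mathlib

open scoped Matrix Kronecker

noncomputable section

/-! ### Qubit registers, operators, locality -/

/-- Labels of the computational basis of a register of qubits indexed by `V`. -/
abbrev Config (V : Type*) := V → Fin 2

/-- Operators on the qubit register indexed by `V`, as matrices in the computational basis. -/
abbrev QOp (V : Type*) := Matrix (Config V) (Config V) ℂ

/-- A normalized pure state of a register. -/
def IsState {V : Type*} [Fintype V] [DecidableEq V] (ψ : Config V → ℂ) : Prop :=
  ∑ x, ‖ψ x‖ ^ 2 = 1

open Classical in
/-- The operator `A` applied to the qubits `f 0, …, f (k - 1)`, tensored with the identity on all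
other qubits. -/
def onQubits {V : Type*} {k : ℕ} (f : Fin k ↪ V) (A : QOp (Fin k)) : QOp V :=
  Matrix.of fun x y => if ∀ v, v ∉ Set.range f → x v = y v then A (x ∘ f) (y ∘ f) else 0

/-- The swap gate exchanging the qubits `q` and `q'`. -/
def swapOp {V : Type*} [Fintype V] [DecidableEq V] (q q' : V) : QOp V :=
  Matrix.of fun x y => if x = y ∘ Equiv.swap q q' then 1 else 0

/-- The projector `|b⟩⟨b|` on the qubit `q`, tensored with the identity on all other qubits. -/
def bitProj {V : Type*} [Fintype V] [DecidableEq V] (q : V) (b : Fin 2) : QOp V :=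
  Matrix.diagonal fun x => if x q = b then 1 else 0

/-- The tensor product `A ⊗ B` as an operator on the union of two registers. -/
def tensorOp {V W : Type*} (A : QOp V) (B : QOp W) : QOp (V ⊕ W) :=
  (A ⊗ₖ B).submatrix (Equiv.sumArrowEquivProdArrow V W (Fin 2))
    (Equiv.sumArrowEquivProdArrow V W (Fin 2))

/-- `A` is of the form `A' ⊗ I`, with the identity acting on the qubit `v`. -/
def ActsTriviallyOn {V : Type*} [DecidableEq V] (A : QOp V) (v : V) : Prop :=
  ∀ x y : Config V,
    A x y = if x v = y v then A (Function.update x v 0) (Function.update y v 0) else 0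

/-- The set of qubits on which `A` acts nontrivially. -/
def opSupport {V : Type*} [DecidableEq V] (A : QOp V) : Set V :=
  {v | ¬ ActsTriviallyOn A v}

/-- Spatial sparsity, with the explicit bound `K`, of the hypergraph on the vertex set `V` with
hyperedges `edge i`: every vertex lies in at most `K` hyperedges, and there is a straight-line
drawing in the plane in which every hyperedge overlaps with at most `K` others and covers an area
of at most `K`. A hyperedge is drawn as the convex polygon spanned by its vertices. Distinct
vertices are drawn at distance at least `1`; this fixes the scale of the drawing, without which the
bound on the area could always be achieved by shrinking. -/
structure IsSpatiallySparse {V I : Type*} (edge : I → Set V) (K : ℕ) : Prop where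
  degree_le : ∀ v, {i | v ∈ edge i}.encard ≤ K
  exists_drawing : ∃ pos : V → EuclideanSpace ℝ (Fin 2),
    (∀ v w, v ≠ w → 1 ≤ dist (pos v) (pos w)) ∧
    (∀ i, {j | j ≠ i ∧
      (convexHull ℝ (pos '' edge i) ∩ convexHull ℝ (pos '' edge j)).Nonempty}.encard ≤ K) ∧
    (∀ i, MeasureTheory.volume (convexHull ℝ (pos '' edge i)) ≤ K)

/-! ### The verifying circuit, laid out in rows -/

/-- A one- or two-qubit unitary gate on distinct wires of a row of `N` qubits. -/
structure Gate (N : ℕ) where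
  arity : ℕ
  arity_pos : 1 ≤ arity
  arity_le : arity ≤ 2
  wires : Fin arity ↪ Fin N
  U : Matrix.unitaryGroup (Config (Fin arity)) ℂ

/-- A circuit of `R` rounds on `N` qubits, with one gate per round; the input register consists of
the qubits of the first row in the columns `inputs`. -/
structure VerifierCircuit (N R : ℕ) where
  gate : Fin R → Gate N
  inputs : Finset (Fin N)

/-- The actions of the cursor: visiting the qubit in row `r` and column `j` during a gate round, or
swapping the qubits of rows `r` and `r'` in column `j`. -/
inductive Step (N R : ℕ) where
  | gate (r : Fin R) (j : Fin N)
  | swap (r r' : Fin R) (j : Fin N)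

/-- Computational qubits: `R` rows (numbered from `0`) of `N` qubits. -/
abbrev CompQubit (N R : ℕ) := Fin R × Fin N

/-- The number `T` of time steps: `R` gate rounds and `R - 1` swap rounds, of `N` steps each. -/
def numSteps (N R : ℕ) : ℕ := (2 * R - 1) * N

/-- The clock qubits; the index `s` stands for `c_{s+1}`. -/
abbrev ClockQubit (N R : ℕ) := Fin (numSteps N R)

/-- All the qubits of the Hamiltonian. -/
abbrev Qubit (N R : ℕ) := CompQubit N R ⊕ ClockQubit N R

/-- The action of the cursor at time `t`, for `1 ≤ t ≤ T`: gate rounds run from left to right, and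
the swap rounds between them from right to left. -/
def step (N R : ℕ) [NeZero N] [NeZero R] (t : ℕ) : Step N R :=
  let b := (t - 1) / N
  let p := (t - 1) % N
  if b % 2 = 0 then
    Step.gate (Fin.ofNat R (b / 2)) (Fin.ofNat N p)
  else
    Step.swap (Fin.ofNat R (b / 2)) (Fin.ofNat R (b / 2 + 1)) (Fin.ofNat N (N - 1 - p))

namespace VerifierCircuit

variable {N R : ℕ} (C : VerifierCircuit N R)

/-- Embedding of the columns as the qubits of row `r`. -/
def rowEmb (r : Fin R) : Fin N ↪ CompQubit N R :=
  ⟨fun j => (r, j), fun _ _ h => (Prod.ext_iff.1 h).2⟩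

open Classical in
/-- The unitary performed in one cursor step. The gate of a round is performed when the cursor
reaches the leftmost of its wires; the other steps of a gate round are identity operations. -/
def stepOp : Step N R → QOp (CompQubit N R)
  | .gate r j =>
      if IsLeast (Set.range (C.gate r).wires) j then
        onQubits ((C.gate r).wires.trans (rowEmb r)) (C.gate r).U
      else 1
  | .swap r r' j => swapOp (r, j) (r', j)

open Classical in
/-- The qubits acted on (possibly by an identity gate) in one cursor step. When the cursor visits a
wire of the gate that has been performed before in the same round, only time advances. -/
def stepQubits : Step N R → Set (CompQubit N R)
  | .gate r j =>
      if IsLeast (Set.range (C.gate r).wires) j then rowEmb r '' Set.range (C.gate r).wires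
      else if j ∈ Set.range (C.gate r).wires then ∅
      else {(r, j)}
  | .swap r r' j => {(r, j), (r', j)}

/-- All two-qubit gates act on neighbouring qubits of their row. -/
def NearestNeighbour : Prop :=
  ∀ r i i', ((C.gate r).wires i : ℕ) ≤ (C.gate r).wires i' + 1

/-- The input qubits `Q_in`. -/
def Qin [NeZero R] : Set (CompQubit N R) := {q | q.1 = 0 ∧ q.2 ∈ C.inputs}

/-- The state `|ξ⟩|0…0⟩` of the computational qubits. -/
def initState [NeZero R] (ξ : Config C.inputs → ℂ) : Config (CompQubit N R) → ℂ :=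
  open Classical in
  fun x => if ∀ q, q ∉ C.Qin → x q = 0 then ξ (fun j => x (0, j)) else 0

variable [NeZero N] [NeZero R]

/-- The operation `U_t`, for `1 ≤ t ≤ T`. -/
def U (t : ℕ) : QOp (CompQubit N R) := C.stepOp (step N R t)

/-- The states `|ξ_t⟩` along the computation. -/
def evolved (ξ : Config C.inputs → ℂ) : ℕ → Config (CompQubit N R) → ℂ
  | 0 => C.initState ξ
  | t + 1 => C.U (t + 1) *ᵥ evolved ξ t

/-- The output qubit: the rightmost qubit of the last row. -/
def qout (N R : ℕ) [NeZero N] [NeZero R] : CompQubit N R :=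
  (Fin.ofNat R (R - 1), Fin.ofNat N (N - 1))

/-- The probability that measuring the output qubit after the computation yields `1`. -/
def acceptProb (ξ : Config C.inputs → ℂ) : ℝ :=
  ∑ x, if x (qout N R) = 1 then ‖C.evolved ξ (numSteps N R) x‖ ^ 2 else 0

/-- The time `t_q` of the earliest action of the cursor on the qubit `q`. -/
def firstTime (q : CompQubit N R) : ℕ :=
  sInf {t | 1 ≤ t ∧ t ≤ numSteps N R ∧ q ∈ C.stepQubits (step N R t)}

/-! ### The clock -/

/-- The value of the clock bit `c_i`, for `1 ≤ i ≤ T`, with the boundary conventions `c_0 = 1` and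
`c_{T+1} = 0`. -/
def clockBit {T : ℕ} (z : Config (Fin T)) (i : ℕ) : Fin 2 :=
  if i = 0 then 1 else if h : i - 1 < T then z ⟨i - 1, h⟩ else 0

open Classical in
/-- The operator `|a⟩⟨b|` on the clock qubits `c_{t-1}, c_t, c_{t+1}`, tensored with the identity on
the other clock qubits. At the boundaries, `c_0` (fixed to `1`) and `c_{T+1}` (fixed to `0`) are
omitted, so that for instance `|100⟩⟨100|` means `|00⟩⟨00|` on `c_1, c_2` for `t = 1`, and
`|10⟩⟨10|` on `c_{T-1}, c_T` for `t = T`. -/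
def clockOp (T t : ℕ) (a b : Fin 3 → Fin 2) : QOp (Fin T) :=
  Matrix.of fun z z' =>
    if (∀ k : Fin 3, clockBit z (t - 1 + k) = a k ∧ clockBit z' (t - 1 + k) = b k) ∧
      (∀ s : Fin T, (∀ k : Fin 3, (s : ℕ) + 1 ≠ t - 1 + k) → z s = z' s)
    then 1 else 0

/-- The clock string `1^t 0^{T-t}`. -/
def clockString (T t : ℕ) : Config (Fin T) := fun s => if (s : ℕ) < t then 1 else 0

/-- The history state. -/
def historyState (ξ : Config C.inputs → ℂ) : Config (Qubit N R) → ℂ := fun x =>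
  ((Real.sqrt (1 / ((numSteps N R : ℝ) + 1)) : ℝ) : ℂ) *
    ∑ t ∈ Finset.range (numSteps N R + 1),
      C.evolved ξ t (x ∘ Sum.inl) *
        (if x ∘ Sum.inr = clockString (numSteps N R) t then 1 else 0)

/-! ### The Hamiltonian -/

/-- `|1⟩⟨1|_q ⊗ |100⟩⟨100|` on `c_{t_q-1}, c_{t_q}, c_{t_q+1}`. -/
def inTerm (q : CompQubit N R) : QOp (Qubit N R) :=
  tensorOp (bitProj q 1) (clockOp (numSteps N R) (C.firstTime q) ![1, 0, 0] ![1, 0, 0])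

/-- `|0⟩⟨0|_{q_out} ⊗ |1⟩⟨1|_{c_T}`. -/
def outTerm (N R : ℕ) [NeZero N] [NeZero R] : QOp (Qubit N R) :=
  tensorOp (bitProj (qout N R) 0)
    (Matrix.diagonal fun z => if clockBit z (numSteps N R) = 1 then 1 else 0)

/-- `|01⟩⟨01|` on `c_t, c_{t+1}`. -/
def clockTerm (N R : ℕ) (t : ℕ) : QOp (Qubit N R) :=
  tensorOp 1 (Matrix.diagonal fun z => if clockBit z t = 0 ∧ clockBit z (t + 1) = 1 then 1 else 0)

/-- `H_evolv(t)`. -/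
def evolvTerm (t : ℕ) : QOp (Qubit N R) :=
  tensorOp 1 (clockOp (numSteps N R) t ![1, 0, 0] ![1, 0, 0])
    + tensorOp 1 (clockOp (numSteps N R) t ![1, 1, 0] ![1, 1, 0])
    - tensorOp (C.U t) (clockOp (numSteps N R) t ![1, 1, 0] ![1, 0, 0])
    - tensorOp (C.U t)ᴴ (clockOp (numSteps N R) t ![1, 0, 0] ![1, 1, 0])

open Classical in
/-- `H_in`. -/
def Hin : QOp (Qubit N R) := ∑ q : {q // q ∉ C.Qin}, C.inTerm q

/-- `H_clock`, the sum over `1 ≤ t ≤ T - 1`. -/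
def Hclock (N R : ℕ) : QOp (Qubit N R) := ∑ s : Fin (numSteps N R - 1), clockTerm N R (s + 1)

/-- The Hamiltonian `H_in + H_out + H_clock + (1/2) ∑_{t=1}^T H_evolv(t)`. -/
def hamiltonian : QOp (Qubit N R) :=
  C.Hin + outTerm N R + Hclock N R
    + (1 / 2 : ℂ) • ∑ s : Fin (numSteps N R), C.evolvTerm (s + 1)

/-- Labels of the terms of `H_in`, `H_out`, `H_clock` and `∑ H_evolv(t)`. -/
abbrev TermIdx := {q // q ∉ C.Qin} ⊕ Unit ⊕ Fin (numSteps N R - 1) ⊕ Fin (numSteps N R)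

/-- The individual terms of the Hamiltonian. -/
def term : C.TermIdx → QOp (Qubit N R)
  | .inl q => C.inTerm q
  | .inr (.inl _) => outTerm N R
  | .inr (.inr (.inl s)) => clockTerm N R (s + 1)
  | .inr (.inr (.inr s)) => (1 / 2 : ℂ) • C.evolvTerm (s + 1)

open Classical in
theorem hamiltonian_eq_sum_term : C.hamiltonian = ∑ i, C.term i := by
  simp [hamiltonian, Hin, Hclock, term, Fintype.sum_sum_type, Finset.smul_sum, add_assoc]

/-- The interaction hypergraph: one hyperedge for every term of the Hamiltonian, consisting of the
qubits on which the term acts nontrivially. -/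
def hyperedge (i : C.TermIdx) : Set (Qubit N R) := opSupport (C.term i)

end VerifierCircuit

end

/-! Completeness. Only `outTerm` sees the history state: the clock strings are valid, consecutive
slices are related by `U_t`, and an ancilla `q` is still `0` at time `t_q - 1`, since no earlier
step touches it. So the energy equals `(1 - p) / (T + 1)`, where `p` is the acceptance probability
(`energy_historyState`).

Soundness. No spectral analysis is needed; the quadratic form is bounded below on an arbitrary
vector `v`. Slice `v` along the clock. Slices at invalid clock strings cost at least their weight in
`Hclock` (`sum_invalid_le_energy_Hclock`). For the valid strings, let `ψ t` be the slice at `1^t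
0^(T-t)` and undo the circuit: `φ t = (U_t ⋯ U_1)ᴴ ψ t`. Since `H_evolv(t)` is a square `Bᴴ B`, it
bounds `‖φ t - φ (t - 1)‖²`, so by Cauchy–Schwarz any two `φ t` have squared distance at most `T`
times the total evolution energy. Let `φ s` be the longest one. The input terms bound its weight on
wrongly initialized strings: undoing the steps before `t_q` does not change the statistics of `q`,
so the penalty at time `t_q - 1` is a penalty on `φ (t_q - 1)`, which is close to `φ s`. Similarly
`outTerm` bounds the rejection weight of `U_T ⋯ U_1 φ s`. But a vector cannot have both weights
small when every proper input is likely to be rejected (`initial_add_reject_ge`). Hence `φ s` is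
short compared with the energy; as it is the longest slice, all valid slices together cost only
another factor `T + 1` (`valid_weight_le`). This yields the bound of order `T⁻³`.

Sparsity. Computational row `r` is drawn at height `3 r`, and the clock follows the cursor back and
forth at heights `3 r + 1` and `3 r + 2`. Every hyperedge then stays within bounded distance of a
lattice point, its home (`home_near_of_mem_hyperedge`), and at most four terms share a home, so
degree, overlaps and areas follow by counting lattice points. -/

noncomputable section

/-! ### Squared norms and energies -/

/-- The squared Euclidean norm of a vector. -/
def normSum {ι : Type*} [Fintype ι] (v : ι → ℂ) : ℝ := ∑ x, ‖v x‖ ^ 2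

/-- The expectation value `⟨v|A|v⟩`. -/
def energy {ι : Type*} [Fintype ι] (A : Matrix ι ι ℂ) (v : ι → ℂ) : ℝ :=
  (star v ⬝ᵥ (A *ᵥ v)).re

section Energy

variable {ι : Type*} [Fintype ι]

theorem normSum_nonneg (v : ι → ℂ) : 0 ≤ normSum v :=
  Finset.sum_nonneg fun _ _ => sq_nonneg _

theorem normSum_eq_norm_sq (v : ι → ℂ) : normSum v = ‖WithLp.toLp 2 v‖ ^ 2 := by
  simp [normSum, EuclideanSpace.norm_sq_eq]

theorem normSum_eq_dotProduct (v : ι → ℂ) : normSum v = (star v ⬝ᵥ v).re := by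
  simp [normSum, dotProduct, ← Complex.normSq_eq_norm_sq, Complex.normSq_apply]

theorem normSum_smul (a : ℂ) (v : ι → ℂ) : normSum (a • v) = ‖a‖ ^ 2 * normSum v := by
  simp [normSum, mul_pow, Finset.mul_sum]

theorem normSum_add_sqrt_le (v w : ι → ℂ) :
    normSum (v + w) ≤ (Real.sqrt (normSum v) + Real.sqrt (normSum w)) ^ 2 := by
  simp only [normSum_eq_norm_sq, Real.sqrt_sq (norm_nonneg _), WithLp.toLp_add]
  gcongr
  exact norm_add_le _ _

theorem normSum_pos {v : ι → ℂ} (hv : v ≠ 0) : 0 < normSum v := by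
  rw [normSum_eq_norm_sq]
  have : WithLp.toLp 2 v ≠ 0 := by simpa using hv
  positivity

theorem normSum_mulVec_of_unitary [DecidableEq ι] {A : Matrix ι ι ℂ} (hA : Aᴴ * A = 1)
    (v : ι → ℂ) : normSum (A *ᵥ v) = normSum v := by
  rw [normSum_eq_dotProduct, normSum_eq_dotProduct, Matrix.star_mulVec, Matrix.dotProduct_mulVec,
    Matrix.vecMul_vecMul, hA, Matrix.vecMul_one]

theorem energy_add (A B : Matrix ι ι ℂ) (v : ι → ℂ) :
    energy (A + B) v = energy A v + energy B v := by
  simp [energy, Matrix.add_mulVec]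

theorem energy_sum {κ : Type*} (s : Finset κ) (A : κ → Matrix ι ι ℂ) (v : ι → ℂ) :
    energy (∑ i ∈ s, A i) v = ∑ i ∈ s, energy (A i) v := by
  simp [energy, Matrix.sum_mulVec, dotProduct_sum]

theorem energy_ofReal_smul (a : ℝ) (A : Matrix ι ι ℂ) (v : ι → ℂ) :
    energy ((a : ℂ) • A) v = a * energy A v := by
  simp [energy, Matrix.smul_mulVec]

theorem energy_diagonal [DecidableEq ι] (p : ι → Prop) [DecidablePred p] (v : ι → ℂ) :
    energy (Matrix.diagonal fun x => if p x then 1 else 0) v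
      = ∑ x, if p x then ‖v x‖ ^ 2 else 0 := by
  simp only [energy, dotProduct, Matrix.mulVec_diagonal, Complex.re_sum]
  refine Finset.sum_congr rfl fun x _ => ?_
  split_ifs
  · simp [← Complex.normSq_eq_norm_sq, Complex.normSq_apply]
  · simp

theorem energy_conjTranspose_mul_self (B : Matrix ι ι ℂ) (v : ι → ℂ) :
    energy (Bᴴ * B) v = normSum (B *ᵥ v) := by
  rw [energy, normSum_eq_dotProduct, Matrix.star_mulVec, ← Matrix.mulVec_mulVec,
    Matrix.dotProduct_mulVec]

theorem energy_of_hasEigenvector [DecidableEq ι] {A : Matrix ι ι ℂ} {μ : ℝ} {v : ι → ℂ}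
    (h : Module.End.HasEigenvector (Matrix.toLin' A) (μ : ℂ) v) :
    energy A v = μ * normSum v := by
  have h1 := h.apply_eq_smul
  rw [Matrix.toLin'_apply] at h1
  rw [energy, h1, normSum_eq_dotProduct, dotProduct_smul, smul_eq_mul, Complex.re_ofReal_mul]

/-- Some value of `f` is at least the average. -/
theorem exists_sum_le_card_mul (f : ℕ → ℝ) (T : ℕ) :
    ∃ s ≤ T, ∑ t ∈ Finset.range (T + 1), f t ≤ (T + 1) * f s := by
  obtain ⟨s, hs, hmax⟩ := Finset.exists_max_image (Finset.range (T + 1)) f ⟨0, by simp⟩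
  refine ⟨s, by simpa [Nat.lt_succ_iff] using hs, ?_⟩
  have := Finset.sum_le_card_nsmul (Finset.range (T + 1)) f (f s) hmax
  simpa using this

theorem norm_sub_le_sum_range {E : Type*} [SeminormedAddCommGroup E] (φ : ℕ → E) {T s t : ℕ}
    (hs : s ≤ T) (ht : t ≤ T) : ‖φ s - φ t‖ ≤ ∑ i ∈ Finset.range T, ‖φ (i + 1) - φ i‖ := by
  wlog hst : t ≤ s generalizing s t
  · rw [norm_sub_rev]
    exact this ht hs (le_of_not_ge hst)
  rw [← Finset.sum_Ico_sub φ hst]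
  refine (norm_sum_le _ _).trans (Finset.sum_le_sum_of_subset_of_nonneg ?_ ?_)
  · intro i hi
    simp only [Finset.mem_Ico, Finset.mem_range] at *
    omega
  · intros
    positivity

/-- Triangle inequality along the path, then Cauchy–Schwarz over its `T` increments. This plays the
role of a spectral gap estimate for the propagation term. -/
theorem normSum_sub_le_sum_range (φ : ℕ → ι → ℂ) {T s t : ℕ} (hs : s ≤ T) (ht : t ≤ T) :
    normSum (φ s - φ t) ≤ T * ∑ i ∈ Finset.range T, normSum (φ (i + 1) - φ i) := by
  simp only [normSum_eq_norm_sq, WithLp.toLp_sub]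
  have h1 := norm_sub_le_sum_range (fun i => WithLp.toLp 2 (φ i)) hs ht
  have h2 := sq_sum_le_card_mul_sum_sq (s := Finset.range T)
    (f := fun i => ‖WithLp.toLp 2 (φ (i + 1)) - WithLp.toLp 2 (φ i)‖)
  rw [Finset.card_range] at h2
  refine le_trans ?_ h2
  gcongr

theorem norm_sq_le_two_mul (a b : ℂ) : ‖a‖ ^ 2 ≤ 2 * ‖b‖ ^ 2 + 2 * ‖a - b‖ ^ 2 := by
  have h : ‖a‖ ≤ ‖b‖ + ‖a - b‖ := by simpa using norm_add_le b (a - b)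
  nlinarith [norm_nonneg a, norm_nonneg b, norm_nonneg (a - b), sq_nonneg (‖b‖ - ‖a - b‖)]

end Energy

/-! ### Operators on registers -/

section Operators

variable {V W : Type*}

theorem tensorOp_apply (A : QOp V) (B : QOp W) (x y : Config (V ⊕ W)) :
    tensorOp A B x y = A (x ∘ Sum.inl) (y ∘ Sum.inl) * B (x ∘ Sum.inr) (y ∘ Sum.inr) := rfl

theorem tensorOp_conjTranspose (A : QOp V) (B : QOp W) :
    (tensorOp A B)ᴴ = tensorOp Aᴴ Bᴴ := by
  ext x y
  simp [tensorOp_apply, Matrix.conjTranspose_apply]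

theorem tensorOp_mul [Fintype V] [DecidableEq V] [Fintype W] [DecidableEq W]
    (A A' : QOp V) (B B' : QOp W) :
    tensorOp A B * tensorOp A' B' = tensorOp (A * A') (B * B') := by
  rw [tensorOp, tensorOp, tensorOp, Matrix.submatrix_mul_equiv, ← Matrix.mul_kronecker_mul]

theorem sum_config_sum [Fintype V] [DecidableEq V] [Fintype W] [DecidableEq W] {M : Type*}
    [AddCommMonoid M] (F : Config (V ⊕ W) → M) :
    ∑ x, F x = ∑ x : Config V, ∑ z : Config W, F (Sum.elim x z) := by
  rw [← Fintype.sum_prod_type',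
    ← (Equiv.sumArrowEquivProdArrow V W (Fin 2)).symm.sum_comp]
  rfl

theorem tensorOp_mulVec [Fintype V] [DecidableEq V] [Fintype W] [DecidableEq W]
    (A : QOp V) (B : QOp W) (v : Config (V ⊕ W) → ℂ) (x : Config V) (z : Config W) :
    (tensorOp A B *ᵥ v) (Sum.elim x z)
      = ∑ z', B z z' * (A *ᵥ fun x' => v (Sum.elim x' z')) x := by
  simp only [Matrix.mulVec, dotProduct, sum_config_sum, tensorOp_apply, Sum.elim_comp_inl,
    Sum.elim_comp_inr, Finset.mul_sum]
  rw [Finset.sum_comm]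
  refine Finset.sum_congr rfl fun _ _ => Finset.sum_congr rfl fun _ _ => by ring

theorem tensorOp_diagonal [Fintype V] [DecidableEq V] [Fintype W] [DecidableEq W] (d : Config V → ℂ)
    (e : Config W → ℂ) : tensorOp (Matrix.diagonal d) (Matrix.diagonal e)
      = Matrix.diagonal fun x => d (x ∘ Sum.inl) * e (x ∘ Sum.inr) := by
  rw [tensorOp, Matrix.diagonal_kronecker_diagonal, Matrix.submatrix_diagonal_equiv]
  rfl

/-- The splitting of a register into the qubits `f 0, …, f (k - 1)` and the others. -/
def configSplit {k : ℕ} (f : Fin k ↪ V) :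
    Config V ≃ Config (Fin k) × Config {v // v ∉ Set.range f} := by
  classical
  exact ((((Equiv.ofInjective f f.injective).sumCongr (Equiv.refl _)).trans
    (Equiv.Set.sumCompl (Set.range f))).arrowCongr (Equiv.refl _)).symm.trans
    (Equiv.sumArrowEquivProdArrow _ _ _)

theorem configSplit_fst {k : ℕ} (f : Fin k ↪ V) (x : Config V) : (configSplit f x).1 = x ∘ f := by
  ext i
  simp [configSplit, Equiv.sumArrowEquivProdArrow]

theorem configSplit_snd {k : ℕ} (f : Fin k ↪ V) (x : Config V) (v : {v // v ∉ Set.range f}) :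
    (configSplit f x).2 v = x v := by
  simp only [configSplit, Equiv.sumArrowEquivProdArrow]
  rfl

open Classical in
-- Exhibits a local gate as a reindexed Kronecker product with an identity, so that unitarity
-- follows from the mixed-product rule.
theorem onQubits_eq_submatrix {k : ℕ} (f : Fin k ↪ V) (A : QOp (Fin k)) :
    onQubits f A = (A ⊗ₖ (1 : QOp {v // v ∉ Set.range f})).submatrix
      (configSplit f) (configSplit f) := by
  ext x y
  have h : (configSplit f x).2 = (configSplit f y).2 ↔ ∀ v, v ∉ Set.range f → x v = y v := by
    simp only [funext_iff, configSplit_snd, Subtype.forall]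
  simp only [onQubits, Matrix.of_apply, Matrix.submatrix_apply, Matrix.kroneckerMap_apply,
    Matrix.one_apply, h, configSplit_fst, mul_ite, mul_one, mul_zero]

theorem onQubits_unitary [Fintype V] [DecidableEq V] {k : ℕ} (f : Fin k ↪ V) {A : QOp (Fin k)}
    (hA : Aᴴ * A = 1) : (onQubits f A)ᴴ * onQubits f A = 1 := by
  classical
  rw [onQubits_eq_submatrix, Matrix.conjTranspose_submatrix, Matrix.submatrix_mul_equiv,
    Matrix.conjTranspose_kronecker, ← Matrix.mul_kronecker_mul, hA]
  simp

theorem swapOp_unitary [Fintype V] [DecidableEq V] (q q' : V) :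
    (swapOp q q')ᴴ * swapOp q q' = 1 := by
  have hinv : ∀ x : Config V, (x ∘ Equiv.swap q q') ∘ Equiv.swap q q' = x := fun x => by
    ext v; simp
  ext x y
  simp only [Matrix.mul_apply, Matrix.conjTranspose_apply, swapOp, Matrix.of_apply,
    Matrix.one_apply]
  rw [Finset.sum_eq_single (x ∘ Equiv.swap q q')]
  · have : x ∘ Equiv.swap q q' = y ∘ Equiv.swap q q' ↔ x = y :=
      ⟨fun h => by rw [← hinv x, h, hinv], fun h => by rw [h]⟩
    simp [this]
  · intro z _ hz
    simp [hz]
  · simp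

/-! ### Locality -/

section Locality

variable [DecidableEq V] [DecidableEq W]

theorem ActsTriviallyOn.apply_eq_zero {A : QOp V} {v : V} (h : ActsTriviallyOn A v)
    {x y : Config V} (hxy : x v ≠ y v) : A x y = 0 := by
  rw [h x y, if_neg hxy]

theorem ActsTriviallyOn.add {A B : QOp V} {v : V} (hA : ActsTriviallyOn A v)
    (hB : ActsTriviallyOn B v) : ActsTriviallyOn (A + B) v := fun x y => by
  simp only [Matrix.add_apply]
  rw [hA x y, hB x y]
  split_ifs <;> simp

theorem ActsTriviallyOn.sub {A B : QOp V} {v : V} (hA : ActsTriviallyOn A v)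
    (hB : ActsTriviallyOn B v) : ActsTriviallyOn (A - B) v := fun x y => by
  simp only [Matrix.sub_apply]
  rw [hA x y, hB x y]
  split_ifs <;> simp

theorem ActsTriviallyOn.smul {A : QOp V} {v : V} (hA : ActsTriviallyOn A v) (a : ℂ) :
    ActsTriviallyOn (a • A) v := fun x y => by
  simp only [Matrix.smul_apply]
  rw [hA x y]
  split_ifs <;> simp

theorem ActsTriviallyOn.conjTranspose {A : QOp V} {v : V} (hA : ActsTriviallyOn A v) :
    ActsTriviallyOn Aᴴ v := fun x y => by
  simp only [Matrix.conjTranspose_apply]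
  rw [hA y x]
  by_cases h : x v = y v
  · simp [h]
  · simp [h, Ne.symm h]

theorem eq_iff_update_eq_update {v : V} {x y : Config V} (h : x v = y v) :
    x = y ↔ Function.update x v 0 = Function.update y v 0 := by
  refine ⟨fun h => by rw [h], fun h' => funext fun w => ?_⟩
  by_cases hw : w = v
  · rw [hw, h]
  · simpa [hw] using congrFun h' w

theorem actsTriviallyOn_diagonal [Fintype V] {d : Config V → ℂ} {v : V}
    (h : ∀ x, d (Function.update x v 0) = d x) : ActsTriviallyOn (Matrix.diagonal d) v := by
  intro x y
  by_cases hxy : x v = y v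
  · rw [if_pos hxy, Matrix.diagonal_apply, Matrix.diagonal_apply, h]
    exact if_congr (eq_iff_update_eq_update hxy) rfl rfl
  · rw [if_neg hxy, Matrix.diagonal_apply_ne]
    exact fun h => hxy (by rw [h])

theorem actsTriviallyOn_one [Fintype V] (v : V) : ActsTriviallyOn (1 : QOp V) v :=
  actsTriviallyOn_diagonal fun _ => rfl

theorem actsTriviallyOn_bitProj [Fintype V] {q v : V} (h : v ≠ q) (b : Fin 2) :
    ActsTriviallyOn (bitProj q b) v :=
  actsTriviallyOn_diagonal fun x => by simp only [Function.update_of_ne h.symm]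

theorem actsTriviallyOn_onQubits {k : ℕ} {f : Fin k ↪ V} {v : V} (hv : v ∉ Set.range f)
    (A : QOp (Fin k)) : ActsTriviallyOn (onQubits f A) v := by
  classical
  intro x y
  have hf : ∀ x : Config V, Function.update x v 0 ∘ f = x ∘ f := fun x => by
    ext i
    simp only [Function.comp_apply]
    rw [Function.update_of_ne]
    rintro rfl
    exact hv ⟨i, rfl⟩
  by_cases hxy : x v = y v
  · rw [if_pos hxy]
    simp only [onQubits, Matrix.of_apply, hf]
    refine if_congr (forall_congr' fun w => ?_) rfl rfl
    by_cases hw : w = v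
    · subst hw
      simp [hxy]
    · simp [hw]
  · rw [if_neg hxy]
    simp only [onQubits, Matrix.of_apply]
    rw [if_neg fun h => hxy (h v hv)]

theorem actsTriviallyOn_swapOp [Fintype V] {q q' v : V} (hq : v ≠ q) (hq' : v ≠ q') :
    ActsTriviallyOn (swapOp q q') v := by
  have hu : ∀ y : Config V, Function.update y v 0 ∘ Equiv.swap q q'
      = Function.update (y ∘ Equiv.swap q q') v 0 := fun y => by
    ext w
    by_cases hw : w = v
    · subst hw
      simp [Equiv.swap_apply_of_ne_of_ne hq hq']
    · have : Equiv.swap q q' w ≠ v := fun h => hw <| by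
        rw [← Equiv.swap_apply_of_ne_of_ne hq hq'] at h
        exact (Equiv.swap q q').injective h
      simp [hw, this]
  intro x y
  have hy : (y ∘ Equiv.swap q q') v = y v := by simp [Equiv.swap_apply_of_ne_of_ne hq hq']
  simp only [swapOp, Matrix.of_apply, hu]
  by_cases hxy : x v = y v
  · rw [if_pos hxy]
    exact if_congr (eq_iff_update_eq_update (hxy.trans hy.symm)) rfl rfl
  · rw [if_neg hxy, if_neg]
    intro h
    exact hxy (by rw [h, hy])

theorem ActsTriviallyOn.tensorOp_inl {A : QOp V} {v : V} (hA : ActsTriviallyOn A v)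
    (B : QOp W) : ActsTriviallyOn (tensorOp A B) (Sum.inl v) := by
  intro x y
  simp only [tensorOp_apply]
  rw [hA]
  simp only [Function.comp_apply, ite_mul, zero_mul]
  refine if_congr Iff.rfl ?_ rfl
  congr 2 <;> ext w
  all_goals simp [Function.update_apply]

theorem ActsTriviallyOn.tensorOp_inr {B : QOp W} {w : W} (hB : ActsTriviallyOn B w)
    (A : QOp V) : ActsTriviallyOn (tensorOp A B) (Sum.inr w) := by
  intro x y
  simp only [tensorOp_apply]
  rw [hB]
  simp only [Function.comp_apply, mul_ite, mul_zero]
  refine if_congr Iff.rfl ?_ rfl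
  congr 2 <;> ext v
  all_goals simp [Function.update_apply]

/-- An operator acting trivially on a qubit commutes with measuring that qubit. -/
theorem ActsTriviallyOn.mulVec_ite [Fintype V] {A : QOp V} {v : V} (hA : ActsTriviallyOn A v)
    (b : Fin 2) (φ : Config V → ℂ) :
    (A *ᵥ fun x => if x v = b then φ x else 0) = fun x => if x v = b then (A *ᵥ φ) x else 0 := by
  ext x
  have h : ∀ y, (A x y * if y v = b then φ y else 0) = if x v = b then A x y * φ y else 0 := by
    intro y
    by_cases hxy : x v = y v
    · simp [hxy]
    · simp [hA.apply_eq_zero hxy]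
  simp only [Matrix.mulVec, dotProduct, h]
  split_ifs <;> simp

end Locality

end Operators

end
noncomputable section

namespace VerifierCircuit

/-! ### Clock operators and clock strings -/

section Clock

variable {T : ℕ}

@[simp]
theorem clockBit_zero (z : Config (Fin T)) : clockBit z 0 = 1 := by simp [clockBit]

@[simp]
theorem clockBit_succ (z : Config (Fin T)) (s : Fin T) : clockBit z (s + 1) = z s := by
  simp [clockBit]

theorem clockBit_of_gt (z : Config (Fin T)) {i : ℕ} (h : T < i) : clockBit z i = 0 := by
  have h1 : i ≠ 0 := by omega
  have h2 : ¬ i - 1 < T := by omega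
  simp [clockBit, h1, h2]

theorem clockBit_update {z : Config (Fin T)} {s : Fin T} {i : ℕ} (h : i ≠ s + 1) (b : Fin 2) :
    clockBit (Function.update z s b) i = clockBit z i := by
  unfold clockBit
  split_ifs with h0 h1
  · rfl
  · rw [Function.update_of_ne]
    intro h2
    apply h
    rw [← h2]
    simp only
    omega
  · rfl

theorem clockBit_clockString {t : ℕ} (ht : t ≤ T) (i : ℕ) :
    clockBit (clockString T t) i = if i ≤ t then 1 else 0 := by
  rcases Nat.eq_zero_or_pos i with rfl | hi
  · simp
  rcases Nat.lt_or_ge T i with hT | hT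
  · rw [clockBit_of_gt _ hT, if_neg (by omega)]
  · have h := clockBit_succ (clockString T t) ⟨i - 1, by omega⟩
    simp only [Nat.sub_add_cancel hi] at h
    rw [h, clockString]
    exact if_congr (by simp only; omega) rfl rfl

theorem clockString_injOn {t t' : ℕ} (ht : t ≤ T) (ht' : t' ≤ T)
    (h : clockString T t = clockString T t') : t = t' := by
  have h1 := clockBit_clockString ht t
  have h2 := clockBit_clockString ht t'
  rw [h, clockBit_clockString ht'] at h1
  rw [h, clockBit_clockString ht'] at h2
  simp only [le_refl, if_true] at h1 h2
  have h3 : t ≤ t' := by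
    by_contra hc
    simp [hc] at h1
  have h4 : t' ≤ t := by
    by_contra hc
    simp [hc] at h2
  omega

/-- A configuration of the clock either is a clock string or violates a clock constraint. -/
theorem exists_clockString_or_violation (z : Config (Fin T)) :
    (∃ t ≤ T, z = clockString T t) ∨
      ∃ s : Fin (T - 1), clockBit z (s + 1) = 0 ∧ clockBit z (s + 1 + 1) = 1 := by
  by_contra! hcon
  obtain ⟨h1, h2⟩ := hcon
  have hb : ∀ b : Fin 2, b ≠ 1 → b = 0 := by decide
  set t := Nat.findGreatest (fun i => clockBit z i = 1) T with ht
  have htT : t ≤ T := Nat.findGreatest_le T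
  have ht1 : clockBit z t = 1 :=
    Nat.findGreatest_spec (P := fun i => clockBit z i = 1) (Nat.zero_le T) (clockBit_zero z)
  have hdown : ∀ k ≤ t, clockBit z (t - k) = 1 := by
    intro k
    induction k with
    | zero => intro _; simpa using ht1
    | succ k ih =>
      intro hk
      have h3 := ih (by omega)
      by_cases h0 : t - (k + 1) = 0
      · simp [h0]
      · by_contra h4
        refine h2 ⟨t - (k + 1) - 1, by omega⟩ ?_ ?_
        · simp only
          rw [Nat.sub_add_cancel (by omega)]
          exact hb _ h4
        · simp only
          rw [Nat.sub_add_cancel (by omega), show t - (k + 1) + 1 = t - k by omega]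
          exact h3
  refine h1 t htT (funext fun s => ?_)
  rw [← clockBit_succ z, ← clockBit_succ (clockString T t), clockBit_clockString htT]
  split_ifs with h
  · have := hdown (t - (s + 1)) (by omega)
    rwa [show t - (t - ((s : ℕ) + 1)) = s + 1 by omega] at this
  · exact hb _ (Nat.findGreatest_is_greatest (P := fun i => clockBit z i = 1)
      (by omega : t < (s : ℕ) + 1) (by omega))

theorem clockOp_conjTranspose (t : ℕ) (a b : Fin 3 → Fin 2) :
    (clockOp T t a b)ᴴ = clockOp T t b a := by
  ext z z'
  simp only [clockOp, Matrix.conjTranspose_apply, Matrix.of_apply, apply_ite star, star_one,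
    star_zero]
  refine if_congr (and_congr ?_ ?_) rfl rfl
  · exact forall_congr' fun k => and_comm
  · exact forall_congr' fun s => imp_congr_right fun _ => eq_comm

open Classical in
theorem clockOp_self (t : ℕ) (a : Fin 3 → Fin 2) :
    clockOp T t a a
      = Matrix.diagonal fun z => if ∀ k : Fin 3, clockBit z (t - 1 + k) = a k then 1 else 0 := by
  ext z z'
  rw [Matrix.diagonal_apply, clockOp, Matrix.of_apply, ← ite_and]
  refine if_congr ⟨fun ⟨h1, h2⟩ => ⟨?_, fun k => (h1 k).1⟩, ?_⟩ rfl rfl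
  · ext1 s
    by_cases hs : ∀ k : Fin 3, (s : ℕ) + 1 ≠ t - 1 + k
    · exact h2 s hs
    · push Not at hs
      obtain ⟨k, hk⟩ := hs
      rw [← clockBit_succ z, ← clockBit_succ z', hk, (h1 k).1, (h1 k).2]
  · rintro ⟨rfl, h⟩
    exact ⟨fun k => ⟨h k, h k⟩, fun _ _ => rfl⟩

/-- Clock operators compose as matrix units, provided that the intermediate bits are compatible
with the boundary conventions. -/
theorem clockOp_mul {s : ℕ} (hs : s < T) (a b c : Fin 3 → Fin 2) (h0 : s = 0 → b 0 = 1)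
    (hT : s + 1 = T → b 2 = 0) :
    clockOp T (s + 1) a b * clockOp T (s + 1) b c = clockOp T (s + 1) a c := by
  ext z z'
  rw [Matrix.mul_apply]
  -- The only intermediate configuration that contributes to the matrix product: `b` on the three
  -- active bits and `z` elsewhere. `h0` and `hT` ensure that `b` agrees with the fixed bits `c_0`
  -- and `c_{T+1}`.
  let y : Config (Fin T) := fun i =>
    if (i : ℕ) + 1 = s then b 0 else if (i : ℕ) = s then b 1 else
      if (i : ℕ) = s + 1 then b 2 else z i
  have hy : ∀ k : Fin 3, clockBit y (s + k) = b k := by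
    intro k
    fin_cases k
    · rcases Nat.eq_zero_or_pos s with h | h
      · simp [h, h0 h]
      · have := clockBit_succ y ⟨s - 1, by omega⟩
        simp only [Nat.sub_add_cancel h] at this
        simp only [Fin.zero_eta, add_zero, this]
        simp [y, Nat.sub_add_cancel h]
    · have := clockBit_succ y ⟨s, hs⟩
      simp only at this
      simp [this, y]
    · rcases Nat.lt_or_ge (s + 1) T with h | h
      · have := clockBit_succ y ⟨s + 1, h⟩
        simp only at this
        change clockBit y (s + 1 + 1) = b 2
        rw [this]
        simp only [y]
        rw [if_neg (by omega), if_neg (by omega), if_pos trivial]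
      · change clockBit y (s + 2) = b 2
        rw [clockBit_of_gt _ (by omega), hT (by omega)]
  have hoff : ∀ i : Fin T, (∀ k : Fin 3, (i : ℕ) + 1 ≠ s + 1 - 1 + k) → y i = z i := by
    intro i hi
    have h1 := hi 0
    have h2 := hi 1
    have h3 := hi 2
    simp only [Fin.val_zero, Fin.val_one, Fin.val_two] at h1 h2 h3
    simp only [y]
    rw [if_neg (by omega), if_neg (by omega), if_neg (by omega)]
  have huniq : ∀ w, clockOp T (s + 1) a b z w ≠ 0 → w = y := by
    intro w hw
    simp only [clockOp, Matrix.of_apply, ne_eq, ite_eq_right_iff, one_ne_zero, imp_false,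
      not_not] at hw
    obtain ⟨hw1, hw2⟩ := hw
    ext1 i
    by_cases hi : ∀ k : Fin 3, (i : ℕ) + 1 ≠ s + 1 - 1 + k
    · rw [← hw2 i hi, hoff i hi]
    · push Not at hi
      obtain ⟨k, hk⟩ := hi
      have h1 := (hw1 k).2
      rw [← hk, clockBit_succ] at h1
      have h2 := hy k
      rw [Nat.add_sub_cancel] at hk
      rw [← hk, clockBit_succ] at h2
      rw [h1, h2]
  rw [Finset.sum_eq_single y]
  · simp only [clockOp, Matrix.of_apply, Nat.add_sub_cancel, hy] at hoff ⊢
    rw [mul_ite, mul_one, mul_zero, ← ite_and]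
    refine if_congr ⟨?_, ?_⟩ rfl rfl
    · rintro ⟨⟨h1, h2⟩, h3, h4⟩
      exact ⟨fun k => ⟨(h3 k).1, (h1 k).2⟩, fun i hi => (h4 i hi).trans (h2 i hi)⟩
    · rintro ⟨h1, h2⟩
      exact ⟨⟨fun k => ⟨trivial, (h1 k).2⟩, fun i hi => (hoff i hi).trans (h2 i hi)⟩,
        fun k => ⟨(h1 k).1, trivial⟩, fun i hi => (hoff i hi).symm⟩
  · intro w _ hw
    by_contra hne
    exact hw (huniq w (left_ne_zero_of_mul hne))
  · simp

theorem actsTriviallyOn_clockOp {t : ℕ} {s : Fin T} (h : ∀ k : Fin 3, (s : ℕ) + 1 ≠ t - 1 + k)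
    (a b : Fin 3 → Fin 2) : ActsTriviallyOn (clockOp T t a b) s := by
  classical
  intro z z'
  have hb : ∀ (z : Config (Fin T)) (k : Fin 3),
      clockBit (Function.update z s 0) (t - 1 + k) = clockBit z (t - 1 + k) :=
    fun z k => clockBit_update (h k).symm _
  by_cases hz : z s = z' s
  · rw [if_pos hz]
    simp only [clockOp, Matrix.of_apply, hb]
    refine if_congr (and_congr_right fun _ => forall_congr' fun i => ?_) rfl rfl
    by_cases hi : i = s
    · subst hi
      simp [hz]
    · simp [hi]
  · rw [if_neg hz]
    simp only [clockOp, Matrix.of_apply]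
    rw [if_neg fun h' => hz (h'.2 s h)]

/-- The pattern `1 b 0` at `c_s, c_{s+1}, c_{s+2}` pins the end of the block of ones to `s + b`, so
on valid strings these local operators are matrix units between the times `s` and `s + 1`. -/
theorem clockOp_apply_clockString {s t : ℕ} (hs : s < T) (ht : t ≤ T) (a b : Fin 2)
    (z : Config (Fin T)) :
    clockOp T (s + 1) ![1, a, 0] ![1, b, 0] z (clockString T t)
      = if t = s + b ∧ z = clockString T (s + a) then 1 else 0 := by
  have ha := a.isLt
  have hbit : ∀ (c : Fin 2) (k : Fin 3),
      clockBit (clockString T (s + c)) (s + k) = (![1, c, 0] : Fin 3 → Fin 2) k := by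
    intro c k
    have hc := c.isLt
    rw [clockBit_clockString (by omega)]
    fin_cases c <;> fin_cases k <;> simp
  rw [clockOp, Matrix.of_apply]
  simp only [Nat.add_sub_cancel]
  refine if_congr ⟨?_, ?_⟩ rfl rfl
  · rintro ⟨h1, h2⟩
    have ht' : t = s + b := by
      have e0 := (h1 0).2
      have e1 := (h1 1).2
      have e2 := (h1 2).2
      simp only [clockBit_clockString ht] at e0 e1 e2
      have f0 : s ≤ t := by
        by_contra hc
        simp [hc] at e0
      have f2 : t < s + 2 := by
        by_contra hc
        simp [not_lt.1 hc] at e2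
      rcases Nat.lt_or_ge t (s + 1) with hlt | hge
      · have : b = 0 := by simpa [not_le.2 hlt, eq_comm] using e1
        simp [this]
        omega
      · have : b = 1 := by simpa [hge, eq_comm] using e1
        simp [this]
        omega
    refine ⟨ht', funext fun i => ?_⟩
    by_cases hi : ∀ k : Fin 3, (i : ℕ) + 1 ≠ s + k
    · rw [h2 i hi, ← clockBit_succ (clockString T t), ← clockBit_succ (clockString T (s + a)),
        clockBit_clockString ht, clockBit_clockString (by omega)]
      have e1 := hi 1
      have hb := b.isLt
      simp only [Fin.val_one] at e1
      refine if_congr ?_ rfl rfl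
      omega
    · push Not at hi
      obtain ⟨k, hk⟩ := hi
      rw [← clockBit_succ z, ← clockBit_succ (clockString T (s + a)), hk, (h1 k).1, hbit]
  · rintro ⟨rfl, rfl⟩
    refine ⟨fun k => ⟨hbit a k, hbit b k⟩, fun i hi => ?_⟩
    rw [← clockBit_succ (clockString T (s + b)), ← clockBit_succ (clockString T (s + a)),
        clockBit_clockString ht, clockBit_clockString (by omega)]
    have e1 := hi 1
    have hb := b.isLt
    simp only [Fin.val_one] at e1
    refine if_congr ?_ rfl rfl
    omega

end Clock

end VerifierCircuit

end
noncomputable section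

namespace VerifierCircuit

variable {N R : ℕ} (C : VerifierCircuit N R)

/-! ### Weights of measurement outcomes -/

/-- The total weight of `φ` on the configurations in which the qubit `q` has the value `b`. -/
def bitWeight {V : Type*} [Fintype V] [DecidableEq V] (q : V) (b : Fin 2) (φ : Config V → ℂ) : ℝ :=
  ∑ x, if x q = b then ‖φ x‖ ^ 2 else 0

theorem bitWeight_nonneg {V : Type*} [Fintype V] [DecidableEq V] (q : V) (b : Fin 2)
    (φ : Config V → ℂ) : 0 ≤ bitWeight q b φ :=
  Finset.sum_nonneg fun _ _ => by positivity

theorem bitWeight_eq_normSum {V : Type*} [Fintype V] [DecidableEq V] (q : V) (b : Fin 2)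
    (φ : Config V → ℂ) : bitWeight q b φ = normSum fun x => if x q = b then φ x else 0 := by
  refine Finset.sum_congr rfl fun x _ => ?_
  by_cases h : x q = b <;> simp [h]

theorem bitWeight_zero_add_one {V : Type*} [Fintype V] [DecidableEq V] (q : V)
    (φ : Config V → ℂ) : bitWeight q 0 φ + bitWeight q 1 φ = normSum φ := by
  rw [bitWeight, bitWeight, normSum, ← Finset.sum_add_distrib]
  refine Finset.sum_congr rfl fun x _ => ?_
  have : x q = 0 ∨ x q = 1 := by
    generalize x q = b
    revert b
    decide
  rcases this with h | h <;> simp [h]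

/-! ### The steps of the circuit -/

theorem actsTriviallyOn_stepOp {st : Step N R} {q : CompQubit N R} (h : q ∉ C.stepQubits st) :
    ActsTriviallyOn (C.stepOp st) q := by
  classical
  cases st with
  | gate r j =>
    simp only [stepOp, stepQubits] at h ⊢
    split_ifs at h ⊢
    · refine actsTriviallyOn_onQubits ?_ _
      rintro ⟨i, rfl⟩
      exact h ⟨_, ⟨i, rfl⟩, rfl⟩
    · exact actsTriviallyOn_one q
    · exact actsTriviallyOn_one q
  | swap r r' j =>
    simp only [stepQubits, Set.mem_insert_iff, Set.mem_singleton_iff, not_or] at h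
    exact actsTriviallyOn_swapOp h.1 h.2

theorem stepOp_unitary (st : Step N R) : (C.stepOp st)ᴴ * C.stepOp st = 1 := by
  classical
  cases st with
  | gate r j =>
    simp only [stepOp]
    split_ifs
    · exact onQubits_unitary _ (Matrix.mem_unitaryGroup_iff'.1 (C.gate r).U.2)
    · simp
  | swap r r' j => exact swapOp_unitary _ _

theorem gate_time_le (r : Fin R) (j : Fin N) : 2 * (r : ℕ) * N + j + 1 ≤ numSteps N R := by
  have hr := r.isLt
  have hj := j.isLt
  have h : (2 * (r : ℕ) + 1) * N ≤ (2 * R - 1) * N := Nat.mul_le_mul_right N (by omega)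
  rw [numSteps]
  linarith

/-! ### Input states inside the full register -/

section Input

variable [NeZero R]

/-- A configuration of the input register, padded by zeros. -/
def padInput (y : Config C.inputs) : Config (CompQubit N R) :=
  fun q => if h : q.1 = 0 ∧ q.2 ∈ C.inputs then y ⟨q.2, h.2⟩ else 0

theorem padInput_apply_of_notMem (y : Config C.inputs) {q : CompQubit N R} (hq : q ∉ C.Qin) :
    C.padInput y q = 0 := dif_neg hq

theorem padInput_comp (y : Config C.inputs) : (fun j : C.inputs => C.padInput y (0, j)) = y := by
  ext j
  simp [padInput]

theorem padInput_eq {x : Config (CompQubit N R)} (hx : ∀ q, q ∉ C.Qin → x q = 0) :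
    C.padInput (fun j => x (0, j)) = x := by
  ext1 q
  by_cases h : q.1 = 0 ∧ q.2 ∈ C.inputs
  · rw [padInput, dif_pos h]
    simp [← h.1]
  · rw [padInput, dif_neg h, hx q h]

theorem initState_padInput (ξ : Config C.inputs → ℂ) (y : Config C.inputs) :
    C.initState ξ (C.padInput y) = ξ y := by
  rw [initState, if_pos fun q hq => C.padInput_apply_of_notMem y hq, padInput_comp]

/-- Lets the acceptance hypothesis, which concerns inputs only, be applied to the correctly
initialized component of an arbitrary vector. -/
theorem initState_comp_padInput {φ : Config (CompQubit N R) → ℂ}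
    (hφ : ∀ x, ¬ (∀ q, q ∉ C.Qin → x q = 0) → φ x = 0) :
    C.initState (fun y => φ (C.padInput y)) = φ := by
  classical
  ext x
  rw [initState]
  split_ifs with h
  · rw [C.padInput_eq h]
  · exact (hφ x h).symm

theorem normSum_initState (ξ : Config C.inputs → ℂ) : normSum (C.initState ξ) = normSum ξ := by
  symm
  refine Finset.sum_of_injOn C.padInput ?_ (by simp) ?_ ?_
  · intro y _ y' _ h
    rw [← C.padInput_comp y, h, padInput_comp]
  · intro x _ hx
    rw [initState, if_neg]
    · simp
    · exact fun h => hx ⟨_, by simp, C.padInput_eq h⟩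
  · intro y _
    rw [initState_padInput]

theorem initState_smul (a : ℂ) (ξ : Config C.inputs → ℂ) :
    C.initState (a • ξ) = a • C.initState ξ := by
  ext x
  simp only [initState, Pi.smul_apply, smul_eq_mul]
  split_ifs <;> simp

end Input

variable [NeZero N] [NeZero R]

theorem numSteps_pos (N R : ℕ) [NeZero N] [NeZero R] : 0 < numSteps N R := by
  have hN := Nat.pos_of_neZero N
  have hR := Nat.pos_of_neZero R
  exact Nat.mul_pos (by omega) hN

/-- With rows numbered from `0`, the gate round of row `r` is preceded by `r` gate rounds and `r`
swap rounds, hence the offset `2 * r * N`. -/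
theorem step_gate_time (r : Fin R) (j : Fin N) :
    step N R (2 * r * N + j + 1) = Step.gate r j := by
  have hN := Nat.pos_of_neZero N
  have hdiv : (2 * (r : ℕ) * N + j) / N = 2 * r := by
    rw [mul_comm, Nat.mul_add_div hN, Nat.div_eq_of_lt j.isLt, add_zero]
  have hmod : (2 * (r : ℕ) * N + j) % N = j := by
    rw [mul_comm, Nat.mul_add_mod, Nat.mod_eq_of_lt j.isLt]
  simp only [step, Nat.add_sub_cancel, hdiv, hmod, Nat.mul_mod_right, if_true]
  congr 1
  · ext
    simp
  · ext
    simp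

/-- Each qubit is acted on in the gate round of its own row: at the leftmost wire of the gate if it
is one of the wires, and at its own column otherwise. So the set of times is nonempty and its `sInf`
is not the default value `0`. -/
theorem firstTime_mem (q : CompQubit N R) :
    1 ≤ C.firstTime q ∧ C.firstTime q ≤ numSteps N R ∧
      q ∈ C.stepQubits (step N R (C.firstTime q)) := by
  classical
  refine Nat.sInf_mem (s := {t | 1 ≤ t ∧ t ≤ numSteps N R ∧ q ∈ C.stepQubits (step N R t)}) ?_
  obtain ⟨r, j⟩ := q
  by_cases hj : j ∈ Set.range (C.gate r).wires
  · obtain ⟨i, hi⟩ := (Set.finite_range (C.gate r).wires).exists_minimal ⟨j, hj⟩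
    have hleast : IsLeast (Set.range (C.gate r).wires) i :=
      ⟨hi.1, fun k hk => (le_total i k).elim id fun h => hi.2 hk h⟩
    refine ⟨2 * r * N + i + 1, by omega, gate_time_le r i, ?_⟩
    rw [step_gate_time]
    simp only [stepQubits, if_pos hleast]
    exact ⟨j, hj, rfl⟩
  · refine ⟨2 * r * N + j + 1, by omega, gate_time_le r j, ?_⟩
    rw [step_gate_time]
    simp only [stepQubits]
    rw [if_neg fun h => hj h.1, if_neg hj]
    rfl

theorem notMem_stepQubits_of_lt {q : CompQubit N R} {t : ℕ} (h1 : 1 ≤ t)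
    (ht : t < C.firstTime q) : q ∉ C.stepQubits (step N R t) := fun h =>
  Nat.notMem_of_lt_sInf ht ⟨h1, ht.le.trans (C.firstTime_mem q).2.1, h⟩

theorem U_unitary (t : ℕ) : (C.U t)ᴴ * C.U t = 1 := C.stepOp_unitary _

theorem actsTriviallyOn_U {q : CompQubit N R} {t : ℕ} (h1 : 1 ≤ t) (ht : t < C.firstTime q) :
    ActsTriviallyOn (C.U t) q :=
  C.actsTriviallyOn_stepOp (C.notMem_stepQubits_of_lt h1 ht)

/-! ### Prefix products of the circuit -/

/-- The product `U_t ⋯ U_1`. -/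
def prefixOp : ℕ → QOp (CompQubit N R)
  | 0 => 1
  | t + 1 => C.U (t + 1) * prefixOp t

theorem prefixOp_unitary (t : ℕ) : (C.prefixOp t)ᴴ * C.prefixOp t = 1 := by
  induction t with
  | zero => simp [prefixOp]
  | succ t ih =>
    rw [prefixOp, Matrix.conjTranspose_mul, Matrix.mul_assoc, ← Matrix.mul_assoc _ (C.U (t + 1)),
      C.U_unitary, Matrix.one_mul, ih]

theorem evolved_eq_prefixOp_mulVec (ξ : Config C.inputs → ℂ) (t : ℕ) :
    C.evolved ξ t = C.prefixOp t *ᵥ C.initState ξ := by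
  induction t with
  | zero => simp [evolved, prefixOp]
  | succ t ih => rw [evolved, ih, prefixOp, Matrix.mulVec_mulVec]

theorem prefixOp_mulVec_ite {q : CompQubit N R} {t : ℕ} (ht : t < C.firstTime q) (b : Fin 2)
    (φ : Config (CompQubit N R) → ℂ) :
    (C.prefixOp t *ᵥ fun x => if x q = b then φ x else 0)
      = fun x => if x q = b then (C.prefixOp t *ᵥ φ) x else 0 := by
  induction t with
  | zero => simp [prefixOp]
  | succ t ih =>
    rw [prefixOp, ← Matrix.mulVec_mulVec, ih (by omega),
      (C.actsTriviallyOn_U (by omega) ht).mulVec_ite, Matrix.mulVec_mulVec]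

/-- Steps before `t_q` commute with the projector on `q` and are unitary. Completeness uses this to
see that ancillas are still `0`, soundness to pull the input penalty back to time `0`. -/
theorem bitWeight_prefixOp_mulVec {q : CompQubit N R} {t : ℕ} (ht : t < C.firstTime q)
    (b : Fin 2) (φ : Config (CompQubit N R) → ℂ) :
    bitWeight q b (C.prefixOp t *ᵥ φ) = bitWeight q b φ := by
  rw [bitWeight_eq_normSum, ← C.prefixOp_mulVec_ite ht,
    normSum_mulVec_of_unitary (C.prefixOp_unitary t), bitWeight_eq_normSum]

/-! ### Norms and acceptance -/

theorem normSum_evolved (ξ : Config C.inputs → ℂ) (t : ℕ) :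
    normSum (C.evolved ξ t) = normSum ξ := by
  rw [evolved_eq_prefixOp_mulVec, normSum_mulVec_of_unitary (C.prefixOp_unitary t),
    normSum_initState]

theorem acceptProb_eq_bitWeight (ξ : Config C.inputs → ℂ) :
    C.acceptProb ξ = bitWeight (qout N R) 1 (C.evolved ξ (numSteps N R)) := rfl

theorem acceptProb_smul (a : ℂ) (ξ : Config C.inputs → ℂ) :
    C.acceptProb (a • ξ) = ‖a‖ ^ 2 * C.acceptProb ξ := by
  simp only [acceptProb, evolved_eq_prefixOp_mulVec, initState_smul, Matrix.mulVec_smul,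
    Pi.smul_apply, norm_smul, mul_pow, Finset.mul_sum, mul_ite, mul_zero]

/-- An acceptance bound for normalized inputs is homogeneous. -/
theorem acceptProb_le {ε : ℝ} (h : ∀ ξ : Config C.inputs → ℂ, IsState ξ → C.acceptProb ξ < ε)
    (ξ : Config C.inputs → ℂ) : C.acceptProb ξ ≤ ε * normSum ξ := by
  by_cases h0 : ξ = 0
  · have := C.acceptProb_smul 0 ξ
    rw [zero_smul, norm_zero, zero_pow two_ne_zero, zero_mul] at this
    simp [this, h0, normSum]
  · have hpos := normSum_pos h0
    set a : ℝ := (Real.sqrt (normSum ξ))⁻¹ with ha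
    have ha2 : ‖(a : ℂ)‖ ^ 2 = (normSum ξ)⁻¹ := by
      rw [Complex.norm_real, Real.norm_eq_abs, sq_abs, ha, inv_pow, Real.sq_sqrt hpos.le]
    have h1 : IsState ((a : ℂ) • ξ) := by
      change normSum ((a : ℂ) • ξ) = 1
      rw [normSum_smul, ha2, inv_mul_cancel₀ hpos.ne']
    have h2 := h _ h1
    rw [acceptProb_smul, ha2, inv_mul_lt_iff₀ hpos] at h2
    linarith

end VerifierCircuit

end
-- Slicing a state along the clock register
noncomputable section

/-- The component of a state of two registers at the configuration `z` of the second one. -/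
def slice {V W : Type*} (v : Config (V ⊕ W) → ℂ) (z : Config W) : Config V → ℂ :=
  fun x => v (Sum.elim x z)

section Slice

variable {V W : Type*} [Fintype V] [DecidableEq V] [Fintype W] [DecidableEq W]

theorem normSum_eq_sum_slice (v : Config (V ⊕ W) → ℂ) :
    normSum v = ∑ z, normSum (slice v z) := by
  simp only [normSum, sum_config_sum, slice]
  exact Finset.sum_comm

theorem energy_bitProj_tensorOp (q : V) (b : Fin 2) (f : Config W → Prop) [DecidablePred f]
    (v : Config (V ⊕ W) → ℂ) :
    energy (tensorOp (bitProj q b) (Matrix.diagonal fun z => if f z then 1 else 0)) v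
      = ∑ z, if f z then VerifierCircuit.bitWeight q b (slice v z) else 0 := by
  have h := energy_diagonal (fun x : Config (V ⊕ W) => (x ∘ Sum.inl) q = b ∧ f (x ∘ Sum.inr)) v
  rw [bitProj, tensorOp_diagonal]
  simp only [ite_zero_mul_ite_zero, mul_one]
  rw [h, sum_config_sum, Finset.sum_comm]
  refine Finset.sum_congr rfl fun z _ => ?_
  simp only [Sum.elim_comp_inl, Sum.elim_comp_inr, VerifierCircuit.bitWeight, slice]
  by_cases hz : f z <;> simp [hz]

theorem energy_one_tensorOp (f : Config W → Prop) [DecidablePred f]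
    (v : Config (V ⊕ W) → ℂ) :
    energy (tensorOp (1 : QOp V) (Matrix.diagonal fun z => if f z then 1 else 0)) v
      = ∑ z, if f z then normSum (slice v z) else 0 := by
  have h := energy_diagonal (fun x : Config (V ⊕ W) => f (x ∘ Sum.inr)) v
  rw [← Matrix.diagonal_one, tensorOp_diagonal]
  simp only [one_mul]
  rw [h, sum_config_sum, Finset.sum_comm]
  refine Finset.sum_congr rfl fun z _ => ?_
  simp only [Sum.elim_comp_inr, normSum, slice]
  by_cases hz : f z <;> simp [hz]

end Slice

namespace VerifierCircuit

/-- A sum over the configurations of the clock, split into clock strings and invalid ones. -/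
theorem sum_config_clock {T : ℕ} {M : Type*} [AddCommMonoid M] (F : Config (Fin T) → M) :
    ∑ z, F z = ∑ t ∈ Finset.range (T + 1), F (clockString T t)
      + ∑ z with ¬ ∃ t ≤ T, z = clockString T t, F z := by
  classical
  rw [← Finset.sum_filter_add_sum_filter_not Finset.univ (fun z => ∃ t ≤ T, z = clockString T t)]
  congr 1
  symm
  refine Finset.sum_bij (fun t _ => clockString T t) ?_ ?_ ?_ ?_
  · intro t ht
    rw [Finset.mem_range, Nat.lt_succ_iff] at ht
    simp only [Finset.mem_filter, Finset.mem_univ, true_and]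
    exact ⟨t, ht, rfl⟩
  · intro t ht t' ht' h
    rw [Finset.mem_range, Nat.lt_succ_iff] at ht ht'
    exact clockString_injOn ht ht' h
  · intro z hz
    simp only [Finset.mem_filter, Finset.mem_univ, true_and] at hz
    obtain ⟨t, ht, rfl⟩ := hz
    exact ⟨t, by simpa [Nat.lt_succ_iff] using ht, rfl⟩
  · intros
    rfl

/-- On valid strings the input penalty for `q` is thus active at time `t_q - 1` only, immediately
before the first action on `q`. -/
theorem forall_clockBit_clockString_iff {T t m : ℕ} (ht : t ≤ T) :
    (∀ k : Fin 3, clockBit (clockString T t) (m - 1 + k) = (![1, 0, 0] : Fin 3 → Fin 2) k)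
      ↔ t = m - 1 := by
  simp only [clockBit_clockString ht]
  constructor
  · intro h
    have h0 := h 0
    have h1 := h 1
    have e0 : m - 1 ≤ t := by
      by_contra hc
      simp [hc] at h0
    have e1 : t < m - 1 + 1 := by
      by_contra hc
      simp [not_lt.1 hc] at h1
    omega
  · rintro rfl k
    fin_cases k <;> simp

/-! ### Energies of the terms -/

variable {N R : ℕ}

theorem energy_clockTerm (t : ℕ) (v : Config (Qubit N R) → ℂ) :
    energy (clockTerm N R t) v = ∑ z, if clockBit z t = 0 ∧ clockBit z (t + 1) = 1 then
      normSum (slice v z) else 0 :=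
  energy_one_tensorOp _ _

/-- `Hclock` is diagonal and counts the patterns `01`; an invalid string has at least one. -/
theorem sum_invalid_le_energy_Hclock (v : Config (Qubit N R) → ℂ) :
    ∑ z with ¬ ∃ t ≤ numSteps N R, z = clockString (numSteps N R) t, normSum (slice v z)
      ≤ energy (Hclock N R) v := by
  rw [Hclock, energy_sum]
  simp only [energy_clockTerm]
  rw [Finset.sum_comm, Finset.sum_filter]
  have hnn : ∀ (z : Config (ClockQubit N R)) (s : Fin (numSteps N R - 1)),
      0 ≤ if clockBit z (s + 1) = 0 ∧ clockBit z (s + 1 + 1) = 1 then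
        normSum (slice v z) else 0 := by
    intro z s
    split_ifs
    exacts [normSum_nonneg _, le_rfl]
  refine Finset.sum_le_sum fun z _ => ?_
  by_cases hz : ∃ t ≤ numSteps N R, z = clockString (numSteps N R) t
  · rw [if_neg (not_not.2 hz)]
    exact Finset.sum_nonneg fun s _ => hnn z s
  · rw [if_pos hz]
    obtain ⟨s, hs⟩ := (exists_clockString_or_violation z).resolve_left hz
    refine le_trans ?_ (Finset.single_le_sum (fun s _ => hnn z s) (Finset.mem_univ s))
    rw [if_pos hs]

variable [NeZero N] [NeZero R] (C : VerifierCircuit N R)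

open Classical in
theorem energy_inTerm (q : CompQubit N R) (v : Config (Qubit N R) → ℂ) :
    energy (C.inTerm q) v = ∑ z, if ∀ k : Fin 3, clockBit z (C.firstTime q - 1 + k)
      = (![1, 0, 0] : Fin 3 → Fin 2) k then bitWeight q 1 (slice v z) else 0 := by
  rw [inTerm, clockOp_self, energy_bitProj_tensorOp]

theorem bitWeight_le_energy_inTerm (q : CompQubit N R) (v : Config (Qubit N R) → ℂ) :
    bitWeight q 1 (slice v (clockString (numSteps N R) (C.firstTime q - 1)))
      ≤ energy (C.inTerm q) v := by
  classical
  obtain ⟨h1, h2, -⟩ := C.firstTime_mem q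
  rw [energy_inTerm]
  refine le_trans ?_ (Finset.single_le_sum (f := fun z => if ∀ k : Fin 3,
    clockBit z (C.firstTime q - 1 + k) = (![1, 0, 0] : Fin 3 → Fin 2) k then
      bitWeight q 1 (slice v z) else 0) (fun z _ => ?_)
    (Finset.mem_univ (clockString (numSteps N R) (C.firstTime q - 1))))
  · rw [if_pos ((forall_clockBit_clockString_iff (by omega)).2 rfl)]
  · split_ifs
    exacts [bitWeight_nonneg _ _ _, le_rfl]

theorem energy_outTerm (v : Config (Qubit N R) → ℂ) :
    energy (outTerm N R) v = ∑ z, if clockBit z (numSteps N R) = 1 then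
      bitWeight (qout N R) 0 (slice v z) else 0 :=
  energy_bitProj_tensorOp _ _ _ _

theorem bitWeight_le_energy_outTerm (v : Config (Qubit N R) → ℂ) :
    bitWeight (qout N R) 0 (slice v (clockString (numSteps N R) (numSteps N R)))
      ≤ energy (outTerm N R) v := by
  rw [energy_outTerm]
  refine le_trans ?_ (Finset.single_le_sum (f := fun z => if clockBit z (numSteps N R) = 1 then
      bitWeight (qout N R) 0 (slice v z) else 0) (fun z _ => ?_)
    (Finset.mem_univ (clockString (numSteps N R) (numSteps N R))))
  · rw [if_pos (by simp [clockBit_clockString])]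
  · split_ifs
    exacts [bitWeight_nonneg _ _ _, le_rfl]

/-- The operator `|100⟩⟨110| - U_t ⊗ |100⟩⟨100|`, a square root of `H_evolv(t)`. -/
def evolvRoot (t : ℕ) : QOp (Qubit N R) :=
  tensorOp 1 (clockOp (numSteps N R) t ![1, 0, 0] ![1, 1, 0])
    - tensorOp (C.U t) (clockOp (numSteps N R) t ![1, 0, 0] ![1, 0, 0])

/-- Multiplying out gives four terms, and `Uᴴ U = 1` removes the gate from one of the diagonal ones.
The outer bits `1` and `0` of the patterns match the boundary conventions, so this is also valid at
the first and the last step. -/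
theorem evolvTerm_eq_conjTranspose_mul {s : ℕ} (hs : s < numSteps N R) :
    C.evolvTerm (s + 1) = (C.evolvRoot (s + 1))ᴴ * C.evolvRoot (s + 1) := by
  have hmul : ∀ a b c : Fin 2,
      clockOp (numSteps N R) (s + 1) ![1, a, 0] ![1, b, 0]
        * clockOp (numSteps N R) (s + 1) ![1, b, 0] ![1, c, 0]
        = clockOp (numSteps N R) (s + 1) ![1, a, 0] ![1, c, 0] := fun a b c =>
    clockOp_mul hs _ _ _ (fun _ => rfl) (fun _ => rfl)
  rw [evolvRoot, Matrix.conjTranspose_sub, tensorOp_conjTranspose, tensorOp_conjTranspose,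
    clockOp_conjTranspose, clockOp_conjTranspose, Matrix.sub_mul, Matrix.mul_sub, Matrix.mul_sub,
    tensorOp_mul, tensorOp_mul, tensorOp_mul, tensorOp_mul, hmul, hmul, hmul, hmul, C.U_unitary,
    evolvTerm]
  simp only [Matrix.conjTranspose_one, Matrix.one_mul, Matrix.mul_one]
  abel

theorem energy_evolvTerm {s : ℕ} (hs : s < numSteps N R) (v : Config (Qubit N R) → ℂ) :
    energy (C.evolvTerm (s + 1)) v
      = ∑ z, normSum (slice (C.evolvRoot (s + 1) *ᵥ v) z) := by
  rw [C.evolvTerm_eq_conjTranspose_mul hs, energy_conjTranspose_mul_self, normSum_eq_sum_slice]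

theorem slice_evolvRoot_mulVec (t : ℕ) (v : Config (Qubit N R) → ℂ)
    (z : Config (ClockQubit N R)) (x : Config (CompQubit N R)) :
    slice (C.evolvRoot t *ᵥ v) z x
      = ∑ z', clockOp (numSteps N R) t ![1, 0, 0] ![1, 1, 0] z z' * slice v z' x
        - ∑ z', clockOp (numSteps N R) t ![1, 0, 0] ![1, 0, 0] z z' * (C.U t *ᵥ slice v z') x := by
  rw [evolvRoot, Matrix.sub_mulVec, slice, Pi.sub_apply, tensorOp_mulVec, tensorOp_mulVec]
  simp only [Matrix.one_mulVec]
  rfl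

theorem slice_evolvRoot_clockString {s : ℕ} (hs : s < numSteps N R)
    (v : Config (Qubit N R) → ℂ) :
    slice (C.evolvRoot (s + 1) *ᵥ v) (clockString (numSteps N R) s)
      = slice v (clockString (numSteps N R) (s + 1))
        - C.U (s + 1) *ᵥ slice v (clockString (numSteps N R) s) := by
  have hrow : ∀ (b : Fin 2) (z : Config (ClockQubit N R)),
      clockOp (numSteps N R) (s + 1) ![1, 0, 0] ![1, b, 0] (clockString (numSteps N R) s) z
        = if z = clockString (numSteps N R) (s + b) then 1 else 0 := by
    intro b z
    -- The clock operators are known on columns indexed by clock strings; taking the adjoint gives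
    -- the row.
    rw [← clockOp_conjTranspose, Matrix.conjTranspose_apply, clockOp_apply_clockString hs hs.le]
    simp [apply_ite]
  ext x
  rw [slice_evolvRoot_mulVec]
  simp [hrow]

theorem normSum_le_energy_evolvTerm {s : ℕ} (hs : s < numSteps N R)
    (v : Config (Qubit N R) → ℂ) :
    normSum (slice v (clockString (numSteps N R) (s + 1))
        - C.U (s + 1) *ᵥ slice v (clockString (numSteps N R) s))
      ≤ energy (C.evolvTerm (s + 1)) v := by
  rw [C.energy_evolvTerm hs, ← C.slice_evolvRoot_clockString hs]
  exact Finset.single_le_sum (f := fun z => normSum (slice (C.evolvRoot (s + 1) *ᵥ v) z))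
    (fun _ _ => normSum_nonneg _) (Finset.mem_univ (clockString (numSteps N R) s))

open Classical in
theorem energy_hamiltonian (v : Config (Qubit N R) → ℂ) :
    energy C.hamiltonian v = ∑ q : {q // q ∉ C.Qin}, energy (C.inTerm q) v
      + energy (outTerm N R) v + energy (Hclock N R) v
      + 1 / 2 * ∑ s : Fin (numSteps N R), energy (C.evolvTerm (s + 1)) v := by
  have h : (1 / 2 : ℂ) = ((1 / 2 : ℝ) : ℂ) := by norm_num
  rw [hamiltonian, Hin, energy_add, energy_add, energy_add, energy_sum, h, energy_ofReal_smul,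
    energy_sum]

theorem hamiltonian_isHermitian : C.hamiltonian.IsHermitian := by
  classical
  have hdiag : ∀ {ι : Type} [DecidableEq ι] (p : ι → Prop) [DecidablePred p],
      (Matrix.diagonal fun x => if p x then (1 : ℂ) else 0)ᴴ
        = Matrix.diagonal fun x => if p x then (1 : ℂ) else 0 := by
    intro ι _ p _
    rw [Matrix.diagonal_conjTranspose]
    congr 1
    ext x
    simp [apply_ite]
  have hin : ∀ q, (C.inTerm q).IsHermitian := fun q => by
    rw [Matrix.IsHermitian, inTerm, tensorOp_conjTranspose, clockOp_conjTranspose, bitProj, hdiag]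
  have hout : (outTerm N R).IsHermitian := by
    rw [Matrix.IsHermitian, outTerm, tensorOp_conjTranspose, bitProj, hdiag, hdiag]
  have hclock : ∀ t, (clockTerm N R t).IsHermitian := fun t => by
    rw [Matrix.IsHermitian, clockTerm, tensorOp_conjTranspose, hdiag, Matrix.conjTranspose_one]
  have hev : ∀ s : Fin (numSteps N R), (C.evolvTerm (s + 1)).IsHermitian := fun s => by
    rw [C.evolvTerm_eq_conjTranspose_mul s.isLt]
    exact Matrix.isHermitian_conjTranspose_mul_self _
  have hsum : ∀ {κ : Type} [Fintype κ] (A : κ → QOp (Qubit N R)), (∀ i, (A i).IsHermitian) →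
      (∑ i, A i).IsHermitian := fun A hA => by
    rw [Matrix.IsHermitian, Matrix.conjTranspose_sum]
    exact Finset.sum_congr rfl fun i _ => hA i
  refine ((Matrix.IsHermitian.add ?_ hout).add ?_).add ?_
  · exact hsum _ fun q => hin q
  · exact hsum _ fun s => hclock _
  · rw [Matrix.IsHermitian, Matrix.conjTranspose_smul, hsum _ hev]
    simp

end VerifierCircuit

end
noncomputable section

namespace VerifierCircuit

variable {N R : ℕ} [NeZero N] [NeZero R] (C : VerifierCircuit N R)

/-! ### Completeness -/

theorem slice_historyState_clockString (ξ : Config C.inputs → ℂ) {t : ℕ}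
    (ht : t ≤ numSteps N R) :
    slice (C.historyState ξ) (clockString (numSteps N R) t)
      = ((Real.sqrt (1 / ((numSteps N R : ℝ) + 1)) : ℝ) : ℂ) • C.evolved ξ t := by
  ext x
  simp only [slice, historyState, Sum.elim_comp_inl, Sum.elim_comp_inr, Pi.smul_apply, smul_eq_mul]
  congr 1
  rw [Finset.sum_eq_single t]
  · simp
  · intro t' ht' hne
    have h : clockString (numSteps N R) t ≠ clockString (numSteps N R) t' := fun h =>
      hne (clockString_injOn ht (by simpa [Nat.lt_succ_iff] using ht') h).symm
    simp [h]
  · intro h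
    exact absurd (Finset.mem_range.2 (Nat.lt_succ_of_le ht)) h

theorem slice_historyState_of_invalid (ξ : Config C.inputs → ℂ) {z : Config (ClockQubit N R)}
    (hz : ¬ ∃ t ≤ numSteps N R, z = clockString (numSteps N R) t) :
    slice (C.historyState ξ) z = 0 := by
  ext x
  simp only [slice, historyState, Sum.elim_comp_inl, Sum.elim_comp_inr, Pi.zero_apply]
  rw [Finset.sum_eq_zero, mul_zero]
  intro t ht
  have h : z ≠ clockString (numSteps N R) t := fun h =>
    hz ⟨t, by simpa [Nat.lt_succ_iff] using ht, h⟩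
  simp [h]

theorem bitWeight_smul {V : Type*} [Fintype V] [DecidableEq V] (q : V) (b : Fin 2) (a : ℂ)
    (φ : Config V → ℂ) : bitWeight q b (a • φ) = ‖a‖ ^ 2 * bitWeight q b φ := by
  simp only [bitWeight, Pi.smul_apply, norm_smul, mul_pow, Finset.mul_sum, mul_ite, mul_zero]

theorem bitWeight_zero {V : Type*} [Fintype V] [DecidableEq V] (q : V) (b : Fin 2) :
    bitWeight q b (0 : Config V → ℂ) = 0 := by
  simp [bitWeight]

theorem energy_inTerm_historyState (ξ : Config C.inputs → ℂ) {q : CompQubit N R}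
    (hq : q ∉ C.Qin) : energy (C.inTerm q) (C.historyState ξ) = 0 := by
  classical
  obtain ⟨h1, h2, -⟩ := C.firstTime_mem q
  rw [energy_inTerm]
  refine Finset.sum_eq_zero fun z _ => ?_
  by_cases hz : ∃ t ≤ numSteps N R, z = clockString (numSteps N R) t
  · obtain ⟨t, ht, rfl⟩ := hz
    split_ifs with h
    · rw [forall_clockBit_clockString_iff ht] at h
      rw [C.slice_historyState_clockString ξ ht, bitWeight_smul, evolved_eq_prefixOp_mulVec,
        C.bitWeight_prefixOp_mulVec (by omega), bitWeight, Finset.sum_eq_zero, mul_zero]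
      intro x _
      split_ifs with hx
      · rw [initState, if_neg]
        · simp
        · intro h'
          simp [h' q hq] at hx
      · rfl
    · rfl
  · rw [C.slice_historyState_of_invalid ξ hz, bitWeight_zero, ite_self]

theorem energy_outTerm_historyState (ξ : Config C.inputs → ℂ) :
    energy (outTerm N R) (C.historyState ξ)
      = 1 / ((numSteps N R : ℝ) + 1)
        * bitWeight (qout N R) 0 (C.evolved ξ (numSteps N R)) := by
  rw [energy_outTerm, Finset.sum_eq_single (clockString (numSteps N R) (numSteps N R))]
  · rw [if_pos (by simp [clockBit_clockString]), C.slice_historyState_clockString ξ le_rfl,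
      bitWeight_smul, Complex.norm_real, Real.norm_eq_abs, sq_abs, Real.sq_sqrt (by positivity)]
  · intro z _ hz
    by_cases hz' : ∃ t ≤ numSteps N R, z = clockString (numSteps N R) t
    · obtain ⟨t, ht, rfl⟩ := hz'
      rw [clockBit_clockString ht, if_neg]
      have : ¬ numSteps N R ≤ t := fun h => hz (by rw [le_antisymm ht h])
      simp [this]
    · rw [C.slice_historyState_of_invalid ξ hz', bitWeight_zero, ite_self]
  · simp

theorem energy_Hclock_historyState (ξ : Config C.inputs → ℂ) :
    energy (Hclock N R) (C.historyState ξ) = 0 := by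
  rw [Hclock, energy_sum]
  refine Finset.sum_eq_zero fun s _ => ?_
  rw [energy_clockTerm]
  refine Finset.sum_eq_zero fun z _ => ?_
  by_cases hz : ∃ t ≤ numSteps N R, z = clockString (numSteps N R) t
  · obtain ⟨t, ht, rfl⟩ := hz
    rw [if_neg]
    rw [clockBit_clockString ht, clockBit_clockString ht]
    rintro ⟨h1, h2⟩
    split_ifs at h1 h2 <;> omega
  · rw [C.slice_historyState_of_invalid ξ hz]
    simp [normSum]

theorem energy_evolvTerm_historyState (ξ : Config C.inputs → ℂ) {s : ℕ}
    (hs : s < numSteps N R) : energy (C.evolvTerm (s + 1)) (C.historyState ξ) = 0 := by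
  rw [C.energy_evolvTerm hs]
  refine Finset.sum_eq_zero fun z _ => ?_
  suffices h : slice (C.evolvRoot (s + 1) *ᵥ C.historyState ξ) z = 0 by
    rw [h]
    simp [normSum]
  by_cases hz : z = clockString (numSteps N R) s
  · rw [hz, C.slice_evolvRoot_clockString hs, C.slice_historyState_clockString ξ hs.le,
      C.slice_historyState_clockString ξ hs, Matrix.mulVec_smul, evolved, sub_self]
  -- From valid strings `evolvRoot` reaches only `clockString s`, and the history state has no
  -- weight on invalid strings, so every other slice vanishes.
  · have hvan : ∀ (b : Fin 2) (F : Config (ClockQubit N R) → ℂ),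
        (∀ z, (¬ ∃ t ≤ numSteps N R, z = clockString (numSteps N R) t) → F z = 0) →
        ∑ z', clockOp (numSteps N R) (s + 1) ![1, 0, 0] ![1, b, 0] z z' * F z' = 0 := by
      intro b F hF
      refine Finset.sum_eq_zero fun z' _ => ?_
      by_cases hz' : ∃ t ≤ numSteps N R, z' = clockString (numSteps N R) t
      · obtain ⟨t, ht, rfl⟩ := hz'
        rw [clockOp_apply_clockString hs ht, if_neg fun h => hz h.2, zero_mul]
      · rw [hF z' hz', mul_zero]
    ext x
    rw [slice_evolvRoot_mulVec, hvan 1, hvan 0]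
    · simp
    · intro z hz
      simp [C.slice_historyState_of_invalid ξ hz]
    · intro z hz
      simp [C.slice_historyState_of_invalid ξ hz]

theorem energy_historyState (ξ : Config C.inputs → ℂ) (hξ : IsState ξ) :
    energy C.hamiltonian (C.historyState ξ)
      = (1 - C.acceptProb ξ) / ((numSteps N R : ℝ) + 1) := by
  classical
  have hnorm := bitWeight_zero_add_one (qout N R) (C.evolved ξ (numSteps N R))
  rw [normSum_evolved, ← acceptProb_eq_bitWeight, show normSum ξ = 1 from hξ] at hnorm
  rw [energy_hamiltonian, Finset.sum_eq_zero fun q _ => C.energy_inTerm_historyState ξ q.2,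
    energy_outTerm_historyState, energy_Hclock_historyState,
    Finset.sum_eq_zero fun s _ => C.energy_evolvTerm_historyState ξ s.isLt,
    show bitWeight (qout N R) 0 (C.evolved ξ (numSteps N R)) = 1 - C.acceptProb ξ by linarith]
  ring

/-! ### Soundness -/

/-- Test the hypothesis on a basis state. Nonnegativity is needed to have `(√ε)² = ε`, as
`Real.sqrt` is `0` on negative numbers. -/
theorem soundness_nonneg {ε : ℝ}
    (h : ∀ ξ : Config C.inputs → ℂ, IsState ξ → C.acceptProb ξ < ε) : 0 ≤ ε := by
  obtain ⟨y⟩ : Nonempty (Config C.inputs) := inferInstance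
  have hs : IsState (Pi.single y (1 : ℂ) : Config C.inputs → ℂ) := by
    rw [IsState, Finset.sum_eq_single y]
    · simp
    · intro y' _ hy'
      simp [hy']
    · simp
  have h1 := h _ hs
  rw [acceptProb_eq_bitWeight] at h1
  exact (bitWeight_nonneg _ _ _).trans h1.le

open Classical in
/-- If every valid input is accepted with small probability, a state cannot both be close to a
valid input and be accepted with large probability. -/
theorem initial_add_reject_ge {ε : ℝ}
    (h : ∀ ξ : Config C.inputs → ℂ, IsState ξ → C.acceptProb ξ < ε)
    (χ : Config (CompQubit N R) → ℂ) :
    (1 - ε - Real.sqrt ε) * normSum χ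
      ≤ (∑ x with ¬ ∀ q, q ∉ C.Qin → x q = 0, ‖χ x‖ ^ 2)
        + bitWeight (qout N R) 0 (C.prefixOp (numSteps N R) *ᵥ χ) := by
  set T := numSteps N R
  -- Split into the correctly initialized part `α` and the rest `β`, of squared norms `a` and `b`.
  -- The acceptance amplitude of `χ` is at most `√(ε a) + √b`, so `b` plus the rejection weight is
  -- at least `(1 - ε) a + b - 2 √ε √(a b)`; `2 √(a b) ≤ a + b` (`key`) and `0 ≤ ε b` (`key2`)
  -- finish.
  let α : Config (CompQubit N R) → ℂ := fun x => if ∀ q, q ∉ C.Qin → x q = 0 then χ x else 0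
  let β : Config (CompQubit N R) → ℂ := fun x => if ∀ q, q ∉ C.Qin → x q = 0 then 0 else χ x
  have hαβ : χ = α + β := by
    ext x
    simp only [α, β, Pi.add_apply]
    split_ifs <;> simp
  have hβ : (∑ x with ¬ ∀ q, q ∉ C.Qin → x q = 0, ‖χ x‖ ^ 2) = normSum β := by
    rw [Finset.sum_filter, normSum]
    refine Finset.sum_congr rfl fun x _ => ?_
    by_cases hx : ∀ q, q ∉ C.Qin → x q = 0
    · simp only [β, if_pos hx, if_neg (not_not.2 hx)]
      simp
    · simp only [β, if_neg hx, if_pos hx]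
  have hsum : normSum χ = normSum α + normSum β := by
    simp only [normSum, ← Finset.sum_add_distrib]
    refine Finset.sum_congr rfl fun x _ => ?_
    by_cases hx : ∀ q, q ∉ C.Qin → x q = 0
    · simp only [α, β, if_pos hx]
      simp
    · simp only [α, β, if_neg hx]
      simp
  have hα : C.initState (fun y => α (C.padInput y)) = α :=
    C.initState_comp_padInput fun x hx => if_neg hx
  have hacc : bitWeight (qout N R) 1 (C.prefixOp T *ᵥ α) ≤ ε * normSum α := by
    have := C.acceptProb_le h fun y => α (C.padInput y)
    rwa [acceptProb_eq_bitWeight, evolved_eq_prefixOp_mulVec, ← normSum_initState, hα] at this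
  have hε : 0 ≤ ε := C.soundness_nonneg h
  have hrejβ : bitWeight (qout N R) 1 (C.prefixOp T *ᵥ β) ≤ normSum β := by
    rw [← normSum_mulVec_of_unitary (C.prefixOp_unitary T) β, ← bitWeight_zero_add_one (qout N R)]
    linarith [bitWeight_nonneg (qout N R) 0 (C.prefixOp T *ᵥ β)]
  have htot := bitWeight_zero_add_one (qout N R) (C.prefixOp T *ᵥ χ)
  rw [normSum_mulVec_of_unitary (C.prefixOp_unitary T)] at htot
  have htri : bitWeight (qout N R) 1 (C.prefixOp T *ᵥ χ)
      ≤ (Real.sqrt ε * Real.sqrt (normSum α) + Real.sqrt (normSum β)) ^ 2 := by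
    have hsplit : (fun x => if x (qout N R) = 1 then (C.prefixOp T *ᵥ χ) x else 0)
        = (fun x => if x (qout N R) = 1 then (C.prefixOp T *ᵥ α) x else 0)
          + fun x => if x (qout N R) = 1 then (C.prefixOp T *ᵥ β) x else 0 := by
      ext x
      rw [hαβ, Matrix.mulVec_add]
      simp only [Pi.add_apply]
      split_ifs <;> simp
    rw [bitWeight_eq_normSum, hsplit]
    refine (normSum_add_sqrt_le _ _).trans ?_
    rw [← bitWeight_eq_normSum, ← bitWeight_eq_normSum, ← Real.sqrt_mul hε]
    gcongr
  rw [hβ]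
  have ha := Real.sq_sqrt (normSum_nonneg α)
  have hb := Real.sq_sqrt (normSum_nonneg β)
  have he := Real.sq_sqrt hε
  have key : 0 ≤ Real.sqrt ε * (Real.sqrt (normSum α) - Real.sqrt (normSum β)) ^ 2 := by positivity
  have key2 : 0 ≤ ε * normSum β := mul_nonneg hε (normSum_nonneg β)
  have hexp : (Real.sqrt ε * Real.sqrt (normSum α) + Real.sqrt (normSum β)) ^ 2
      = ε * normSum α + normSum β
        + 2 * Real.sqrt ε * Real.sqrt (normSum α) * Real.sqrt (normSum β) := by
    rw [add_sq, mul_pow, ha, hb, he]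
    ring
  have hexp2 : Real.sqrt ε * (Real.sqrt (normSum α) - Real.sqrt (normSum β)) ^ 2
      = Real.sqrt ε * (normSum α + normSum β)
        - 2 * Real.sqrt ε * Real.sqrt (normSum α) * Real.sqrt (normSum β) := by
    rw [sub_sq, ha, hb]
    ring
  have hgoal : (1 - ε - Real.sqrt ε) * normSum χ
      = normSum α + normSum β - ε * normSum α - ε * normSum β
        - Real.sqrt ε * (normSum α + normSum β) := by
    rw [hsum]
    ring
  linarith

/-- A quantitative bound: the weight of the valid clock strings in a state costs energy. -/
theorem valid_weight_le {ε : ℝ} (hpos : 0 ≤ 1 - ε - Real.sqrt ε)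
    (h : ∀ ξ : Config C.inputs → ℂ, IsState ξ → C.acceptProb ξ < ε)
    (v : Config (Qubit N R) → ℂ) :
    (1 - ε - Real.sqrt ε) * ∑ t ∈ Finset.range (numSteps N R + 1),
        normSum (slice v (clockString (numSteps N R) t))
      ≤ 20 * (numSteps N R : ℝ) ^ 3 * (energy C.hamiltonian v - energy (Hclock N R) v) := by
  classical
  have hT1 : (1 : ℝ) ≤ numSteps N R := by exact_mod_cast numSteps_pos N R
  set T := numSteps N R
  set ψ : ℕ → Config (CompQubit N R) → ℂ := fun t => slice v (clockString T t)
  set φ : ℕ → Config (CompQubit N R) → ℂ := fun t => (C.prefixOp t)ᴴ *ᵥ ψ t with hφ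
  have hVφ : ∀ t, C.prefixOp t *ᵥ φ t = ψ t := fun t => by
    rw [hφ, Matrix.mulVec_mulVec, mul_eq_one_comm.1 (C.prefixOp_unitary t),
      Matrix.one_mulVec]
  have hnorm : ∀ t, normSum (ψ t) = normSum (φ t) := fun t => by
    rw [← hVφ t, normSum_mulVec_of_unitary (C.prefixOp_unitary t)]
  set Ein := ∑ q : {q // q ∉ C.Qin}, energy (C.inTerm q) v
  set Eout := energy (outTerm N R) v
  set Eev := ∑ s : Fin T, energy (C.evolvTerm (s + 1)) v
  have hE : energy C.hamiltonian v - energy (Hclock N R) v = Ein + Eout + 1 / 2 * Eev := by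
    rw [energy_hamiltonian]
    ring
  have hin : ∑ q : {q // q ∉ C.Qin}, bitWeight q.1 1 (φ (C.firstTime q - 1)) ≤ Ein := by
    refine Finset.sum_le_sum fun q _ => ?_
    have h1 := (C.firstTime_mem q.1).1
    rw [← C.bitWeight_prefixOp_mulVec (t := C.firstTime q - 1) (by omega), hVφ]
    exact C.bitWeight_le_energy_inTerm q v
  have hin0 : 0 ≤ Ein := le_trans (Finset.sum_nonneg fun _ _ => bitWeight_nonneg _ _ _) hin
  have hout : bitWeight (qout N R) 0 (ψ T) ≤ Eout := bitWeight_le_energy_outTerm v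
  have hout0 : 0 ≤ Eout := (bitWeight_nonneg _ _ _).trans hout
  have hev : ∑ i ∈ Finset.range T, normSum (φ (i + 1) - φ i) ≤ Eev := by
    rw [Finset.sum_range]
    refine Finset.sum_le_sum fun s _ => ?_
    -- Applying `U_{s+1} ⋯ U_1` turns the increment of `φ` into `ψ (s + 1) - U_{s+1} ψ s`, the
    -- residual penalized by the evolution term.
    rw [← normSum_mulVec_of_unitary (C.prefixOp_unitary (s + 1)), Matrix.mulVec_sub, hVφ,
      prefixOp, ← Matrix.mulVec_mulVec, hVφ]
    exact C.normSum_le_energy_evolvTerm s.isLt v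
  have hev0 : 0 ≤ Eev := le_trans (Finset.sum_nonneg fun _ _ => normSum_nonneg _) hev
  -- The longest slice is the reference vector: bounding it alone bounds the total valid weight up
  -- to the factor `T + 1`.
  obtain ⟨s, hs, hmax⟩ := exists_sum_le_card_mul (fun t => normSum (ψ t)) T
  rw [hnorm s] at hmax
  have hdist : ∀ t ≤ T, normSum (φ s - φ t) ≤ T * Eev := fun t ht =>
    (normSum_sub_le_sum_range φ hs ht).trans (mul_le_mul_of_nonneg_left hev (by positivity))
  have hinit : (∑ x with ¬ ∀ q, q ∉ C.Qin → x q = 0, ‖φ s x‖ ^ 2)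
      ≤ 2 * Ein + 2 * ∑ t ∈ Finset.range T, normSum (φ s - φ t) := by
    -- Pointwise in `x`: choose one violated ancilla `q` and compare `φ s` with `φ (t_q - 1)`. As
    -- `t_q - 1 < T`, the difference occurs among the terms of the sum over all times, whichever `q`
    -- was chosen.
    have hpt : ∀ x : Config (CompQubit N R), (¬ ∀ q, q ∉ C.Qin → x q = 0) →
        ‖φ s x‖ ^ 2 ≤ 2 * (∑ q : {q // q ∉ C.Qin},
            if x q = 1 then ‖φ (C.firstTime q - 1) x‖ ^ 2 else 0)
          + 2 * ∑ t ∈ Finset.range T, ‖(φ s - φ t) x‖ ^ 2 := by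
      intro x hx
      push Not at hx
      obtain ⟨q, hq, hxq⟩ := hx
      have hxq1 : x q = 1 := by
        revert hxq
        generalize x q = b
        revert b
        decide
      have h1 := C.firstTime_mem q
      have e1 := Finset.single_le_sum (f := fun q : {q // q ∉ C.Qin} =>
        if x q = 1 then ‖φ (C.firstTime q - 1) x‖ ^ 2 else 0)
        (fun _ _ => by positivity) (Finset.mem_univ ⟨q, hq⟩)
      have e2 := Finset.single_le_sum (f := fun t => ‖(φ s - φ t) x‖ ^ 2)
        (fun _ _ => by positivity)
        (Finset.mem_range.2 (show C.firstTime q - 1 < T by omega))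
      have e3 := norm_sq_le_two_mul (φ s x) (φ (C.firstTime q - 1) x)
      simp only [hxq1, if_true, Pi.sub_apply] at e1 e2
      simp only [Pi.sub_apply]
      linarith
    have hnn : ∀ x : Config (CompQubit N R), 0 ≤ 2 * (∑ q : {q // q ∉ C.Qin},
            if x q = 1 then ‖φ (C.firstTime q - 1) x‖ ^ 2 else 0)
          + 2 * ∑ t ∈ Finset.range T, ‖(φ s - φ t) x‖ ^ 2 := fun x => by positivity
    rw [Finset.sum_filter]
    refine (Finset.sum_le_sum fun x _ => ?_).trans (b := ∑ x, (2 * (∑ q : {q // q ∉ C.Qin},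
            if x q = 1 then ‖φ (C.firstTime q - 1) x‖ ^ 2 else 0)
          + 2 * ∑ t ∈ Finset.range T, ‖(φ s - φ t) x‖ ^ 2)) ?_
    · split_ifs with hx
      · exact hnn x
      · exact hpt x hx
    · rw [Finset.sum_add_distrib, ← Finset.mul_sum, ← Finset.mul_sum, Finset.sum_comm,
        Finset.sum_comm (s := Finset.univ) (t := Finset.range T)]
      exact add_le_add_left (mul_le_mul_of_nonneg_left hin zero_le_two) _
  have hrej : bitWeight (qout N R) 0 (C.prefixOp T *ᵥ φ s)
      ≤ 2 * Eout + 2 * normSum (φ s - φ T) := by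
    rw [← normSum_mulVec_of_unitary (C.prefixOp_unitary T) (φ s - φ T), Matrix.mulVec_sub, hVφ]
    refine le_trans ?_ (add_le_add_left (mul_le_mul_of_nonneg_left hout zero_le_two) _)
    rw [bitWeight, bitWeight, normSum, Finset.mul_sum, Finset.mul_sum, ← Finset.sum_add_distrib]
    refine Finset.sum_le_sum fun x _ => ?_
    split_ifs
    · exact norm_sq_le_two_mul _ _
    · positivity
  have hcomb := C.initial_add_reject_ge h (φ s)
  have hdsum : ∑ t ∈ Finset.range T, normSum (φ s - φ t) + normSum (φ s - φ T)
      ≤ (T + 1) * (T * Eev) := by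
    rw [← Finset.sum_range_succ]
    have := Finset.sum_le_card_nsmul (Finset.range (T + 1)) (fun t => normSum (φ s - φ t))
      (T * Eev) fun t ht => hdist t (by simpa [Nat.lt_succ_iff] using ht)
    simpa using this
  -- The `T + 1` distances, each at most `T * Eev`, contribute `2 (T + 1) T * Eev ≤ 5 T² * Eev`; the
  -- weight `1/2` of the evolution terms turns the `5` into `10`.
  have hχ : (1 - ε - Real.sqrt ε) * normSum (φ s) ≤ 10 * (T : ℝ) ^ 2 * (Ein + Eout + 1 / 2 * Eev) := by
    have hA : (1 - ε - Real.sqrt ε) * normSum (φ s)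
        ≤ 2 * (Ein + Eout) + 2 * ((T + 1) * (T * Eev)) := by linarith
    have hT2 : (1 : ℝ) ≤ (T : ℝ) ^ 2 := one_le_pow₀ hT1
    have hB : 2 * (Ein + Eout) ≤ 10 * (T : ℝ) ^ 2 * (Ein + Eout) :=
      mul_le_mul_of_nonneg_right (by linarith) (by linarith)
    have hC : 2 * (((T : ℝ) + 1) * (T * Eev)) ≤ 10 * (T : ℝ) ^ 2 * (1 / 2 * Eev) := by
      have : 2 * (((T : ℝ) + 1) * T) ≤ 5 * (T : ℝ) ^ 2 := by nlinarith
      nlinarith [mul_le_mul_of_nonneg_right this hev0]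
    linarith
  rw [hE]
  calc (1 - ε - Real.sqrt ε) * ∑ t ∈ Finset.range (T + 1), normSum (ψ t)
      ≤ (1 - ε - Real.sqrt ε) * ((T + 1) * normSum (φ s)) := mul_le_mul_of_nonneg_left hmax hpos
    _ = (T + 1) * ((1 - ε - Real.sqrt ε) * normSum (φ s)) := by ring
    _ ≤ (2 * T) * (10 * (T : ℝ) ^ 2 * (Ein + Eout + 1 / 2 * Eev)) := by
        refine mul_le_mul (by linarith) hχ ?_ (by positivity)
        exact mul_nonneg hpos (normSum_nonneg _)
    _ = 20 * (T : ℝ) ^ 3 * (Ein + Eout + 1 / 2 * Eev) := by ring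

theorem energy_hamiltonian_nonneg (v : Config (Qubit N R) → ℂ) : 0 ≤ energy C.hamiltonian v := by
  classical
  rw [energy_hamiltonian]
  have h1 : ∀ q, 0 ≤ energy (C.inTerm q) v := fun q =>
    (bitWeight_nonneg _ _ _).trans (C.bitWeight_le_energy_inTerm q v)
  have h2 := (bitWeight_nonneg _ _ _).trans (bitWeight_le_energy_outTerm v)
  have h3 := (Finset.sum_nonneg fun _ _ => normSum_nonneg _).trans (sum_invalid_le_energy_Hclock v)
  have h4 : ∀ s : Fin (numSteps N R), 0 ≤ energy (C.evolvTerm (s + 1)) v := fun s =>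
    (normSum_nonneg _).trans (C.normSum_le_energy_evolvTerm s.isLt v)
  have h5 := Finset.sum_nonneg fun (q : {q // q ∉ C.Qin}) (_ : q ∈ Finset.univ) => h1 q
  have h6 := Finset.sum_nonneg fun s (_ : s ∈ Finset.univ) => h4 s
  linarith

theorem energy_hamiltonian_ge {ε : ℝ}
    (h : ∀ ξ : Config C.inputs → ℂ, IsState ξ → C.acceptProb ξ < ε)
    (v : Config (Qubit N R) → ℂ) :
    1 / 20 * (1 - ε - Real.sqrt ε) / (numSteps N R : ℝ) ^ 3 * normSum v
      ≤ energy C.hamiltonian v := by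
  have hT1 : (1 : ℝ) ≤ numSteps N R := by exact_mod_cast numSteps_pos N R
  have hT3 : (1 : ℝ) ≤ (numSteps N R : ℝ) ^ 3 := one_le_pow₀ hT1
  -- For a negative prefactor, positivity of the Hamiltonian suffices.
  rcases lt_or_ge (1 - ε - Real.sqrt ε) 0 with hneg | hpos
  · refine le_trans ?_ (C.energy_hamiltonian_nonneg v)
    refine mul_nonpos_of_nonpos_of_nonneg (div_nonpos_of_nonpos_of_nonneg ?_ ?_)
      (normSum_nonneg v)
    · linarith
    · positivity
  have hε0 : 0 ≤ ε := C.soundness_nonneg h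
  have hle1 : 1 - ε - Real.sqrt ε ≤ 1 := by linarith [Real.sqrt_nonneg ε]
  have h1 := C.valid_weight_le hpos h v
  have h2 := sum_invalid_le_energy_Hclock v
  have h3 := normSum_eq_sum_slice v
  rw [sum_config_clock] at h3
  set A := ∑ t ∈ Finset.range (numSteps N R + 1),
    normSum (slice v (clockString (numSteps N R) t))
  set B := ∑ z with ¬ ∃ t ≤ numSteps N R, z = clockString (numSteps N R) t, normSum (slice v z)
  have hB : 0 ≤ B := Finset.sum_nonneg fun _ _ => normSum_nonneg _
  rw [h3, div_mul_eq_mul_div, div_le_iff₀ (by positivity)]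
  -- This restores the clock energy that `valid_weight_le` leaves out; the constant is generous, as
  -- `1 - ε - √ε ≤ 1 ≤ 20 T³`.
  have h4 : (1 - ε - Real.sqrt ε) * B ≤ 20 * (numSteps N R : ℝ) ^ 3 * energy (Hclock N R) v := by
    refine mul_le_mul (by linarith) h2 hB (by positivity)
  linarith

theorem le_of_hasEigenvalue {ε : ℝ}
    (h : ∀ ξ : Config C.inputs → ℂ, IsState ξ → C.acceptProb ξ < ε) {μ : ℝ}
    (hμ : Module.End.HasEigenvalue (Matrix.toLin' C.hamiltonian) (μ : ℂ)) :
    1 / 20 * (1 - ε - Real.sqrt ε) / (numSteps N R : ℝ) ^ 3 ≤ μ := by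
  obtain ⟨v, hv⟩ := hμ.exists_hasEigenvector
  have h1 := C.energy_hamiltonian_ge h v
  rw [energy_of_hasEigenvector hv] at h1
  exact le_of_mul_le_mul_right h1 (normSum_pos hv.2)

end VerifierCircuit

end
noncomputable section

namespace VerifierCircuit

/-! ### Supports of the terms -/

section Support

variable {N R : ℕ} (C : VerifierCircuit N R)

/-- The clock qubits among `c_m, c_{m+1}, c_{m+2}`. -/
def clockTriple (N R m : ℕ) : Set (Qubit N R) :=
  Sum.inr '' {s | ∃ k : Fin 3, (s : ℕ) + 1 = m + k}

theorem opSupport_smul_subset {V : Type*} [DecidableEq V] (a : ℂ) (A : QOp V) :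
    opSupport (a • A) ⊆ opSupport A := fun _ hv h => hv (h.smul a)

theorem encard_clockTriple_le (m : ℕ) : (clockTriple N R m).encard ≤ 3 := by
  rw [clockTriple, Sum.inr_injective.encard_image]
  have hinj : Function.Injective fun s : ClockQubit N R => (s : ℕ) + 1 := fun s s' h =>
    Fin.ext (Nat.succ_injective h)
  rw [← hinj.encard_image]
  refine (Set.encard_le_encard (t := Set.range fun k : Fin 3 => m + (k : ℕ)) ?_).trans ?_
  · rintro _ ⟨s, ⟨k, hk⟩, rfl⟩
    exact ⟨k, hk.symm⟩
  · rw [← Set.image_univ]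
    refine (Set.encard_image_le _ _).trans ?_
    simp

theorem encard_stepQubits_le (st : Step N R) : (C.stepQubits st).encard ≤ 2 := by
  classical
  cases st with
  | gate r j =>
    simp only [stepQubits]
    split_ifs
    · refine (Set.encard_image_le _ _).trans ?_
      rw [← Set.image_univ]
      refine (Set.encard_image_le _ _).trans ?_
      simp only [Set.encard_univ, ENat.card_eq_coe_fintype_card, Fintype.card_fin]
      exact_mod_cast (C.gate r).arity_le
    · simp
    · simp
  | swap r r' j =>
    refine (Set.encard_insert_le _ _).trans ?_
    rw [Set.encard_singleton]
    norm_num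

theorem opSupport_clockTerm_subset (t : ℕ) : opSupport (clockTerm N R t) ⊆ clockTriple N R t := by
  intro v hv
  by_contra hcon
  refine hv ?_
  rcases v with q' | s
  · exact (actsTriviallyOn_one q').tensorOp_inl _
  · refine (actsTriviallyOn_diagonal fun z => ?_).tensorOp_inr _
    rw [clockBit_update, clockBit_update]
    · exact fun h => hcon ⟨s, ⟨1, h.symm⟩, rfl⟩
    · exact fun h => hcon ⟨s, ⟨0, h.symm⟩, rfl⟩

variable [NeZero N] [NeZero R]

theorem opSupport_inTerm_subset (q : CompQubit N R) :
    opSupport (C.inTerm q) ⊆ insert (Sum.inl q) (clockTriple N R (C.firstTime q - 1)) := by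
  intro v hv
  by_contra hcon
  simp only [Set.mem_insert_iff, not_or] at hcon
  refine hv ?_
  rcases v with q' | s
  · exact (actsTriviallyOn_bitProj (fun h => hcon.1 (by rw [h])) 1).tensorOp_inl _
  · refine (actsTriviallyOn_clockOp (fun k hk => hcon.2 ⟨s, ⟨k, hk⟩, rfl⟩) _ _).tensorOp_inr _

theorem opSupport_outTerm_subset :
    opSupport (outTerm N R) ⊆ insert (Sum.inl (qout N R)) (clockTriple N R (numSteps N R)) := by
  intro v hv
  by_contra hcon
  simp only [Set.mem_insert_iff, not_or] at hcon
  refine hv ?_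
  rcases v with q' | s
  · exact (actsTriviallyOn_bitProj (fun h => hcon.1 (by rw [h])) 0).tensorOp_inl _
  · refine (actsTriviallyOn_diagonal fun z => ?_).tensorOp_inr _
    rw [clockBit_update]
    exact fun h => hcon.2 ⟨s, ⟨0, h.symm⟩, rfl⟩

theorem opSupport_evolvTerm_subset (t : ℕ) :
    opSupport (C.evolvTerm t)
      ⊆ Sum.inl '' C.stepQubits (step N R t) ∪ clockTriple N R (t - 1) := by
  intro v hv
  by_contra hcon
  simp only [Set.mem_union, not_or] at hcon
  refine hv ?_
  rcases v with q | s
  · have hU : ActsTriviallyOn (C.U t) q :=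
      C.actsTriviallyOn_stepOp fun h => hcon.1 ⟨q, h, rfl⟩
    exact ((((actsTriviallyOn_one q).tensorOp_inl _).add
      ((actsTriviallyOn_one q).tensorOp_inl _)).sub (hU.tensorOp_inl _)).sub
      (hU.conjTranspose.tensorOp_inl _)
  · have hc := fun a b => actsTriviallyOn_clockOp (t := t) (s := s)
      (fun k hk => hcon.2 ⟨s, ⟨k, hk⟩, rfl⟩) a b
    exact ((((hc _ _).tensorOp_inr _).add ((hc _ _).tensorOp_inr _)).sub
      ((hc _ _).tensorOp_inr _)).sub ((hc _ _).tensorOp_inr _)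

theorem encard_hyperedge_le (i : C.TermIdx) : (C.hyperedge i).encard ≤ 5 := by
  have hins : ∀ (v : Qubit N R) (m : ℕ), (insert v (clockTriple N R m)).encard ≤ 5 := by
    intro v m
    refine (Set.encard_insert_le _ _).trans ((add_le_add_left (encard_clockTriple_le m) 1).trans ?_)
    norm_num
  rcases i with q | u | s | s
  · exact (Set.encard_le_encard (C.opSupport_inTerm_subset q)).trans (hins _ _)
  · exact (Set.encard_le_encard opSupport_outTerm_subset).trans (hins _ _)
  · refine (Set.encard_le_encard (opSupport_clockTerm_subset _)).trans
      ((encard_clockTriple_le _).trans ?_)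
    norm_num
  · refine (Set.encard_le_encard ((opSupport_smul_subset _ _).trans
      (C.opSupport_evolvTerm_subset _))).trans ?_
    refine (Set.encard_union_le _ _).trans ?_
    rw [Sum.inl_injective.encard_image]
    refine (add_le_add (C.encard_stepQubits_le _) (encard_clockTriple_le _)).trans ?_
    norm_num

end Support

/-! ### The drawing -/

/-- The place of the clock qubit with index `s`: the clock follows the path of the cursor. -/
def clockPos (N s : ℕ) : ℤ × ℤ :=
  if s / N % 2 = 0 then (((s % N : ℕ) : ℤ), 3 * ((s / N / 2 : ℕ) : ℤ) + 1)
  else ((N : ℤ) - 1 - ((s % N : ℕ) : ℤ), 3 * ((s / N / 2 : ℕ) : ℤ) + 2)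

/-- The place of a qubit in the drawing. -/
def qubitPos {N R : ℕ} : Qubit N R → ℤ × ℤ
  | .inl q => ((q.2 : ℕ), 3 * ((q.1 : ℕ) : ℤ))
  | .inr s => clockPos N s

/-- Lattice points at distance at most `d` in both coordinates. -/
def Near (d : ℤ) (a b : ℤ × ℤ) : Prop := |a.1 - b.1| ≤ d ∧ |a.2 - b.2| ≤ d

theorem Near.symm {d : ℤ} {a b : ℤ × ℤ} (h : Near d a b) : Near d b a := by
  rwa [Near, abs_sub_comm, abs_sub_comm b.2]

theorem Near.trans {d e : ℤ} {a b c : ℤ × ℤ} (h : Near d a b) (h' : Near e b c) :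
    Near (d + e) a c :=
  ⟨(abs_sub_le _ b.1 _).trans (add_le_add h.1 h'.1), (abs_sub_le _ b.2 _).trans (add_le_add h.2 h'.2)⟩

theorem Near.mono {d e : ℤ} {a b : ℤ × ℤ} (h : Near d a b) (hde : d ≤ e) : Near e a b :=
  ⟨h.1.trans hde, h.2.trans hde⟩

theorem near_refl {d : ℤ} (hd : 0 ≤ d) (a : ℤ × ℤ) : Near d a a := by simp [Near, hd]

theorem clockPos_injective {N : ℕ} : Function.Injective (clockPos N) := by
  intro s s' h
  have h1 := Nat.div_add_mod s N
  have h2 := Nat.div_add_mod s' N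
  have hfst := congrArg Prod.fst h
  have hsnd := congrArg Prod.snd h
  have key : s / N = s' / N ∧ s % N = s' % N := by
    unfold clockPos at hfst hsnd
    split_ifs at hfst hsnd <;> simp only at hfst hsnd <;> omega
  rw [← h1, ← h2, key.1, key.2]

/-- Computational qubits lie at heights divisible by `3`, clock qubits never do. Distinct lattice
points are at distance at least `1`, as the drawing requires. -/
theorem qubitPos_injective {N R : ℕ} : Function.Injective (qubitPos (N := N) (R := R)) := by
  have hne : ∀ (q : CompQubit N R) (s : ClockQubit N R),
      qubitPos (Sum.inl q : Qubit N R) ≠ qubitPos (Sum.inr s : Qubit N R) := by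
    intro q s h
    have h2 := congrArg Prod.snd h
    simp only [qubitPos, clockPos] at h2
    split_ifs at h2 <;> simp only at h2 <;> omega
  rintro (q | s) (q' | s') h
  · simp only [qubitPos, Prod.mk.injEq] at h
    congr 1
    ext <;> omega
  · exact absurd h (hne q s')
  · exact absurd h.symm (hne q' s)
  · exact congrArg Sum.inr (Fin.ext (clockPos_injective h))

/-- Within a round the path moves one column. Between rounds it keeps its column, because the
direction reverses, and rises by `1` or, after a swap round, by `2`. -/
theorem clockPos_near_succ {N : ℕ} [NeZero N] (s : ℕ) :
    Near 2 (clockPos N s) (clockPos N (s + 1)) := by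
  have hN := Nat.pos_of_neZero N
  have hlt := Nat.mod_lt s hN
  have hs := Nat.div_add_mod s N
  rcases Nat.lt_or_ge (s % N + 1) N with h | h
  · have hd : (s + 1) / N = s / N := by
      rw [show s + 1 = N * (s / N) + (s % N + 1) by omega, Nat.mul_add_div hN,
        Nat.div_eq_of_lt h, add_zero]
    have hm : (s + 1) % N = s % N + 1 := by
      rw [show s + 1 = N * (s / N) + (s % N + 1) by omega, Nat.mul_add_mod, Nat.mod_eq_of_lt h]
    simp only [Near, clockPos, hd, hm]
    split_ifs <;> simp only [abs_le] <;> push_cast <;> omega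
  · have hN' : s % N + 1 = N := by omega
    have hd : (s + 1) / N = s / N + 1 := by
      rw [show s + 1 = N * (s / N) + N by omega, Nat.mul_add_div hN, Nat.div_self hN]
    have hm : (s + 1) % N = 0 := by
      rw [show s + 1 = N * (s / N) + N by omega, Nat.mul_add_mod, Nat.mod_self]
    simp only [Near, clockPos, hd, hm]
    split_ifs <;> simp only [abs_le] <;> omega

theorem clockPos_near_of_mem_clockTriple {N R : ℕ} [NeZero N] {s m : ℕ}
    (h1 : s + 1 ≤ m + 2) (h2 : m ≤ s + 1)
    {v : Qubit N R} (hv : v ∈ clockTriple N R m) : Near 4 (clockPos N s) (qubitPos v) := by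
  obtain ⟨s', ⟨k, hk⟩, rfl⟩ := hv
  have hk3 := k.isLt
  have h4 : ∀ a, Near 4 (clockPos N a) (clockPos N (a + 2)) := fun a =>
    ((clockPos_near_succ a).trans (clockPos_near_succ (a + 1))).mono (by norm_num)
  change Near 4 (clockPos N s) (clockPos N s')
  obtain h | h | h | h | h : (s' : ℕ) = s ∨ (s' : ℕ) = s + 1 ∨ (s' : ℕ) = s + 2 ∨ s = s' + 1
      ∨ s = s' + 2 := by omega
  · rw [h]
    exact near_refl (by norm_num) _
  · rw [h]
    exact (clockPos_near_succ s).mono (by norm_num)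
  · rw [h]
    exact h4 s
  · rw [h]
    exact (clockPos_near_succ _).symm.mono (by norm_num)
  · rw [h]
    exact (h4 _).symm

/-- The place around which a hyperedge is drawn. -/
def home {N R : ℕ} [NeZero R] (C : VerifierCircuit N R) : C.TermIdx → ℤ × ℤ
  | .inl q => qubitPos (Sum.inl q.1 : Qubit N R)
  | .inr (.inl _) => clockPos N (numSteps N R - 1)
  | .inr (.inr (.inl s)) => clockPos N s
  | .inr (.inr (.inr s)) => clockPos N s

/-- The kind of a term: input, output, clock or evolution. -/
def termKind {N R : ℕ} [NeZero R] (C : VerifierCircuit N R) : C.TermIdx → Fin 4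
  | .inl _ => 0
  | .inr (.inl _) => 1
  | .inr (.inr (.inl _)) => 2
  | .inr (.inr (.inr _)) => 3

/-- At most one term of each kind has a given home, so counting terms reduces to counting lattice
points, with a factor `4`. -/
theorem termKind_home_injective {N R : ℕ} [NeZero R] (C : VerifierCircuit N R) :
    Function.Injective fun i => (C.termKind i, C.home i) := by
  rintro (q | u | s | s) (q' | u' | s' | s') h <;>
    simp only [termKind, home, Prod.mk.injEq] at h <;>
    first
    | exact absurd h.1 (by decide)
    | skip
  · exact congrArg _ (Subtype.ext (Sum.inl_injective (qubitPos_injective h.2)))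
  · rfl
  · rw [Fin.ext (clockPos_injective h.2)]
  · rw [Fin.ext (clockPos_injective h.2)]

theorem encard_le_of_home_near {N R : ℕ} [NeZero R] (C : VerifierCircuit N R)
    {d : ℕ} {p : ℤ × ℤ} {S : Set C.TermIdx}
    (hS : ∀ i ∈ S, Near d p (C.home i)) : S.encard ≤ (4 * (2 * d + 1) ^ 2 : ℕ) := by
  rw [← C.termKind_home_injective.encard_image]
  let B : Finset (Fin 4 × ℤ × ℤ) := Finset.univ ×ˢ
    (Finset.Icc (p.1 - d) (p.1 + d) ×ˢ Finset.Icc (p.2 - d) (p.2 + d))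
  have hB : B.card = 4 * (2 * d + 1) ^ 2 := by
    have : ∀ a : ℤ, (a + d + 1 - (a - d)).toNat = 2 * d + 1 := fun a => by omega
    simp only [B, Finset.card_product, Finset.card_univ, Fintype.card_fin, Int.card_Icc, this]
    ring
  rw [← hB, ← Set.encard_coe_eq_coe_finsetCard]
  refine Set.encard_le_encard ?_
  rintro _ ⟨i, hi, rfl⟩
  have h := hS i hi
  simp only [Near, abs_le] at h
  simp only [B, Finset.coe_product, Set.mem_prod, Finset.mem_coe, Finset.mem_univ,
    Finset.mem_Icc, true_and]
  omega

theorem rowEmb_apply {N R : ℕ} (r : Fin R) (j : Fin N) : rowEmb r j = (r, j) := rfl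

variable {N R : ℕ} [NeZero N] [NeZero R] (C : VerifierCircuit N R)

/-- The clock qubit of a step sits in the column the cursor visits, just above the row of a gate or
between the two rows of a swap. The nearest-neighbour assumption serves to keep the other wire of a
gate within one column. -/
theorem clockPos_near_stepQubits (hC : C.NearestNeighbour) {s : ℕ} (hs : s < numSteps N R)
    {q : CompQubit N R} (hq : q ∈ C.stepQubits (step N R (s + 1))) :
    Near 2 (clockPos N s) (qubitPos (Sum.inl q : Qubit N R)) := by
  classical
  have hN := Nat.pos_of_neZero N
  have hR := Nat.pos_of_neZero R
  have hb : s / N < 2 * R - 1 := (Nat.div_lt_iff_lt_mul hN).2 hs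
  have hp := Nat.mod_lt s hN
  simp only [step, Nat.add_sub_cancel] at hq
  by_cases he : s / N % 2 = 0
  · have hr : s / N / 2 < R := by omega
    rw [if_pos he] at hq
    simp only [stepQubits] at hq
    simp only [Near, clockPos, if_pos he, qubitPos, abs_le]
    split_ifs at hq with h1 h2
    · obtain ⟨j, ⟨i, rfl⟩, rfl⟩ := hq
      obtain ⟨⟨i', hi'⟩, -⟩ := h1
      have e1 := hC _ i i'
      have e2 := hC _ i' i
      rw [hi'] at e1 e2
      simp only [rowEmb_apply, Fin.val_ofNat, Nat.mod_mod, Nat.mod_eq_of_lt hr] at e1 e2 ⊢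
      omega
    · exact absurd hq (Set.notMem_empty _)
    · rw [Set.mem_singleton_iff] at hq
      subst hq
      simp only [Fin.val_ofNat, Nat.mod_eq_of_lt hr, Nat.mod_mod]
      omega
  · have hr : s / N / 2 + 1 < R := by omega
    rw [if_neg he] at hq
    simp only [stepQubits, Set.mem_insert_iff, Set.mem_singleton_iff] at hq
    simp only [Near, clockPos, if_neg he, qubitPos, abs_le]
    have hj : (N - 1 - s % N) % N = N - 1 - s % N := Nat.mod_eq_of_lt (by omega)
    rcases hq with rfl | rfl
    · simp only [Fin.val_ofNat, Nat.mod_eq_of_lt (show s / N / 2 < R by omega), hj]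
      omega
    · simp only [Fin.val_ofNat, Nat.mod_eq_of_lt hr, hj]
      omega

theorem home_near_of_mem_hyperedge (hC : C.NearestNeighbour) {i : C.TermIdx} {v : Qubit N R}
    (hv : v ∈ C.hyperedge i) : Near 6 (C.home i) (qubitPos v) := by
  have hT := numSteps_pos N R
  rcases i with q | u | s | s
  · obtain ⟨h1, h2, h3⟩ := C.firstTime_mem q.1
    rcases C.opSupport_inTerm_subset q hv with rfl | hv
    · exact near_refl (by norm_num) _
    · rw [show C.firstTime q = C.firstTime q - 1 + 1 by omega] at h3
      exact ((C.clockPos_near_stepQubits hC (by omega) h3).symm.trans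
        (clockPos_near_of_mem_clockTriple (by omega) (by omega) hv)).mono (by norm_num)
  · rcases opSupport_outTerm_subset hv with rfl | hv
    · have hN := Nat.pos_of_neZero N
      have hR := Nat.pos_of_neZero R
      have hs : numSteps N R - 1 = N * (2 * (R - 1)) + (N - 1) := by
        obtain ⟨R', rfl⟩ : ∃ R', R = R' + 1 := ⟨R - 1, by omega⟩
        rw [numSteps, show 2 * (R' + 1) - 1 = 2 * R' + 1 by omega, Nat.add_sub_cancel]
        rw [add_mul, one_mul, mul_comm N]
        omega
      have hd : (numSteps N R - 1) / N = 2 * (R - 1) := by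
        rw [hs, Nat.mul_add_div hN, Nat.div_eq_of_lt (by omega), add_zero]
      have hm : (numSteps N R - 1) % N = N - 1 := by
        rw [hs, Nat.mul_add_mod, Nat.mod_eq_of_lt (by omega)]
      simp only [home, clockPos, hd, hm, Near, qubitPos, qout, Fin.val_ofNat, abs_le,
        Nat.mod_eq_of_lt (show N - 1 < N by omega), Nat.mod_eq_of_lt (show R - 1 < R by omega)]
      rw [if_pos (by omega)]
      simp only
      omega
    · exact (clockPos_near_of_mem_clockTriple (by omega) (by omega) hv).mono (by norm_num)
  · exact (clockPos_near_of_mem_clockTriple (by omega) (by omega)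
      (opSupport_clockTerm_subset _ hv)).mono (by norm_num)
  · rcases C.opSupport_evolvTerm_subset _ (opSupport_smul_subset _ _ hv) with ⟨q, hq, rfl⟩ | hv
    · exact (C.clockPos_near_stepQubits hC s.isLt hq).mono (by norm_num)
    · exact (clockPos_near_of_mem_clockTriple (by omega) (by omega) hv).mono (by norm_num)

/-! ### From lattice points to the Euclidean plane -/

/-- A lattice point as a point of the Euclidean plane. -/
def planePoint (p : ℤ × ℤ) : EuclideanSpace ℝ (Fin 2) := !₂[(p.1 : ℝ), (p.2 : ℝ)]

theorem dist_planePoint_sq (p p' : ℤ × ℤ) :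
    dist (planePoint p) (planePoint p') ^ 2
      = (((p.1 - p'.1) ^ 2 + (p.2 - p'.2) ^ 2 : ℤ) : ℝ) := by
  rw [EuclideanSpace.dist_eq, Real.sq_sqrt (by positivity)]
  simp [planePoint, Fin.sum_univ_two, Real.dist_eq, sq_abs]

theorem one_le_dist_planePoint {p p' : ℤ × ℤ} (h : p ≠ p') :
    1 ≤ dist (planePoint p) (planePoint p') := by
  rw [← one_le_sq_iff₀ dist_nonneg, dist_planePoint_sq]
  have h0 : 0 < (p.1 - p'.1) ^ 2 + (p.2 - p'.2) ^ 2 := by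
    by_contra hc
    refine h (Prod.ext ?_ ?_) <;> nlinarith [sq_nonneg (p.1 - p'.1), sq_nonneg (p.2 - p'.2)]
  exact_mod_cast h0

theorem Near.dist_planePoint_le {p p' : ℤ × ℤ} (h : Near 6 p p') :
    dist (planePoint p) (planePoint p') ≤ 9 := by
  refine le_of_sq_le_sq ?_ (by norm_num)
  rw [dist_planePoint_sq]
  have h1 := sq_le_sq' (abs_le.1 h.1).1 (abs_le.1 h.1).2
  have h2 := sq_le_sq' (abs_le.1 h.2).1 (abs_le.1 h.2).2
  -- Here `6² + 6² = 72`; rounding up to `81` gives the integer radius `9`.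
  have : (p.1 - p'.1) ^ 2 + (p.2 - p'.2) ^ 2 ≤ 81 := by linarith
  calc _ ≤ ((81 : ℤ) : ℝ) := by exact_mod_cast this
    _ = 9 ^ 2 := by norm_num

theorem near_of_dist_planePoint_le {p p' : ℤ × ℤ} {d : ℕ}
    (h : dist (planePoint p) (planePoint p') ≤ d) : Near d p p' := by
  have h1 : dist (planePoint p) (planePoint p') ^ 2 ≤ (d : ℝ) ^ 2 := by gcongr
  rw [dist_planePoint_sq] at h1
  have h2 : (p.1 - p'.1) ^ 2 + (p.2 - p'.2) ^ 2 ≤ (d : ℤ) ^ 2 := by exact_mod_cast h1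
  exact ⟨abs_le_of_sq_le_sq (by linarith [sq_nonneg (p.2 - p'.2)]) (by positivity),
    abs_le_of_sq_le_sq (by linarith [sq_nonneg (p.1 - p'.1)]) (by positivity)⟩

/-- Each convex hull lies in a disc of radius `9` about its home, so hulls that meet have homes at
distance at most `18`. This allows `4 * 37² = 5476` terms; the same number amply covers the degree
and the area `81 π`. -/
theorem isSpatiallySparse_hyperedge (hC : C.NearestNeighbour) :
    IsSpatiallySparse C.hyperedge 5476 := by
  have hhull : ∀ i, convexHull ℝ ((fun v => planePoint (qubitPos v)) '' C.hyperedge i)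
      ⊆ Metric.closedBall (planePoint (C.home i)) 9 := by
    intro i
    refine convexHull_min ?_ (convex_closedBall _ _)
    rintro _ ⟨v, hv, rfl⟩
    exact (C.home_near_of_mem_hyperedge hC hv).symm.dist_planePoint_le
  refine ⟨fun v => ?_, fun v => planePoint (qubitPos v), ?_, ?_, ?_⟩
  · refine C.encard_le_of_home_near (d := 18) (p := qubitPos v) fun i hi => ?_
    exact (C.home_near_of_mem_hyperedge hC hi).symm.mono (by norm_num)
  · exact fun v w h => one_le_dist_planePoint fun h' => h (qubitPos_injective h')
  · intro i
    refine C.encard_le_of_home_near (d := 18) (p := C.home i) ?_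
    rintro j ⟨-, x, hx, hx'⟩
    refine near_of_dist_planePoint_le ?_
    have h1 := hhull i hx
    have h2 := hhull j hx'
    rw [Metric.mem_closedBall] at h1 h2
    have h3 := dist_triangle_left (planePoint (C.home i)) (planePoint (C.home j)) x
    push_cast
    linarith
  · intro i
    refine (MeasureTheory.measure_mono (hhull i)).trans ?_
    rw [EuclideanSpace.volume_closedBall_fin_two]
    calc ENNReal.ofReal 9 ^ 2 * ENNReal.ofReal Real.pi
        ≤ ENNReal.ofReal 9 ^ 2 * ENNReal.ofReal 4 := by
          gcongr
          exact Real.pi_le_four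
      _ = ENNReal.ofReal 324 := by
          rw [← ENNReal.ofReal_pow (by norm_num), ← ENNReal.ofReal_mul (by norm_num)]
          norm_num
      _ ≤ ENNReal.ofReal ((5476 : ℕ) : ℝ) := ENNReal.ofReal_le_ofReal (by norm_num)
      _ = ((5476 : ℕ) : ENNReal) := ENNReal.ofReal_natCast _

end VerifierCircuit

end
-- Assembly of the lemma
theorem lemma1 :
    ∃ c : ℝ, 0 < c ∧ ∃ K : ℕ,
      ∀ (N R : ℕ) [NeZero N] [NeZero R] (C : VerifierCircuit N R),
        C.hamiltonian.IsHermitian ∧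
        (∀ i, (C.hyperedge i).encard ≤ 5) ∧
        (C.NearestNeighbour → IsSpatiallySparse C.hyperedge K) ∧
        (∀ (ε : ℝ) (ξ : Config C.inputs → ℂ), IsState ξ → 1 - ε < C.acceptProb ξ →
          (star (C.historyState ξ) ⬝ᵥ (C.hamiltonian *ᵥ C.historyState ξ)).re
            < ε / ((numSteps N R : ℝ) + 1)) ∧
        (∀ ε : ℝ, (∀ ξ : Config C.inputs → ℂ, IsState ξ → C.acceptProb ξ < ε) →
          ∀ μ : ℝ, Module.End.HasEigenvalue (Matrix.toLin' C.hamiltonian) (μ : ℂ) →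
            c * (1 - ε - Real.sqrt ε) / (numSteps N R : ℝ) ^ 3 ≤ μ) := by
  -- `1 / 20` inverts the factor `20` of `valid_weight_le`; `5476` is the lattice-point count of the
  -- drawing.
  refine ⟨1 / 20, by norm_num, 5476, fun N R _ _ C => ⟨C.hamiltonian_isHermitian,
    C.encard_hyperedge_le, C.isSpatiallySparse_hyperedge, fun ε ξ hξ hacc => ?_,
    fun ε h μ hμ => C.le_of_hasEigenvalue h hμ⟩⟩
  change energy C.hamiltonian (C.historyState ξ) < _
  rw [C.energy_historyState ξ hξ]
  have : 1 - C.acceptProb ξ < ε := by linarith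
  gcongr
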